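/- Let $S\subset\mathbb{C}^2$ be the curve $(y^2+x^3)(y^2-x^3)=0$, two cusps meeting at the origin, and for $x\in\mathbb{C}$ let $K(x)=\{y : (x,y)\in S\}$. The projection to the $x$-axis has degree $4$ on $S$, and $x=0$ is the only point with $|K(x)|<4$. Let $E=\{|x|\le r\}$, $r>0$, let $M\in\partial E$, and let $D$ be a closed disc whose interior $\mathring D$ contains $K(x)$ for all $x\in E$. Let $B_4$ be the braid group on four strings in $D$ based at $K(M)$, i.e. the fundamental group, based at $K(M)$, of the space of $4$-element subsets of $\mathring D$, and let $$\varphi:\pi_1(E\setminus\{0\},M)\to B_4$$ be the braid monodromy of $S$, which sends the class of a loop $\gamma$ to the class of the motion $t\mapsto K(\gamma(t))$. List the points of $K(M)$ as $p_1,p_2,p_3,p_4$ by increasing real part, and by increasing imaginary part where real parts agree, and let $\sigma_i\in B_4$ be the positive (counterclockwise) half-twist along the segment $[p_i,p_{i+1}]$, $i=1,2,3$. Let $\Gamma(t)=Me^{2\pi i t}$, $0\le t\le 1$. Then $$\varphi([\Gamma])=(\sigma_2\sigma_1\sigma_3)^6,$$ and the local braid monodromy of $S$ at the origin is generated by this braid,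 that is, the image of $\varphi$ is the cyclic subgroup of $B_4$ generated by $(\sigma_2\sigma_1\sigma_3)^6$. -/

import Mathlib

open Polynomial

noncomputable section

namespace BraidMonodromy

/-! ### Configuration spaces and braid groups -/

/-- Ordered configurations of `n` distinct points of `U ⊆ ℂ`, with the subspace topology. -/
def OConf (U : Set ℂ) (n : ℕ) : Type :=
  {p : Fin n → ℂ // Function.Injective p ∧ ∀ k, p k ∈ U}

instance (U : Set ℂ) (n : ℕ) : TopologicalSpace (OConf U n) :=
  inferInstanceAs (TopologicalSpace {p : Fin n → ℂ // Function.Injective p ∧ ∀ k, p k ∈ U})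

/-- Unordered configurations: the `n`-element subsets of `U ⊆ ℂ`. -/
def UConf (U : Set ℂ) (n : ℕ) : Type :=
  {s : Set ℂ // s ⊆ U ∧ s.encard = n}

/-- Forget the order of the points. -/
def OConf.forget {U : Set ℂ} {n : ℕ} (p : OConf U n) : UConf U n :=
  ⟨Set.range p.1, by
    rintro _ ⟨k, rfl⟩
    exact p.2.2 k, by
    rw [← Set.image_univ, p.2.1.encard_image, Set.encard_univ]
    simp⟩

/-- The quotient topology from the ordered configurations. -/
instance (U : Set ℂ) (n : ℕ) : TopologicalSpace (UConf U n) :=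
  TopologicalSpace.coinduced OConf.forget inferInstance

theorem OConf.continuous_forget {U : Set ℂ} {n : ℕ} :
    Continuous (OConf.forget : OConf U n → UConf U n) :=
  continuous_coinduced_rng

/-- The (geometric) braid group on `n` strings in `U` based at the `n`-point set `s`:
the fundamental group of the space of `n`-element subsets of `U`. For `U` an open disc this is
Artin's braid group `B_n`. -/
abbrev BraidGroup (U : Set ℂ) (n : ℕ) (s : UConf U n) : Type :=
  FundamentalGroup (UConf U n) s

/-! ### Half-twists along segments -/

/-- A closed elliptical neighbourhood of the segment `[a, b]`: the long axis is `[a, b]`, and `ε` is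
the ratio of the short axis to the long one. -/
def twistNhd (a b : ℂ) (ε : ℝ) : Set ℂ :=
  (fun w : ℂ => (a + b) / 2 + (b - a) / 2 * (⟨w.re, ε * w.im⟩ : ℂ)) '' Metric.closedBall 0 1

/-- `ε` is small enough for the half-twist of the `i`-th and the `j`-th point of `p` inside the
elliptical neighbourhood of thickness `ε`: this neighbourhood lies in `U` and contains no other
point of the configuration. -/
def OConf.Admissible {U : Set ℂ} {n : ℕ} (p : OConf U n) (i j : Fin n) (ε : ℝ) : Prop :=
  0 < ε ∧ twistNhd (p.1 i) (p.1 j) ε ⊆ U \ p.1 '' {k | k ≠ i ∧ k ≠ j}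

/-- `exp (π i t)` squeezed to the ellipse with half-axes `1` and `ε`. -/
def ellipseArc (ε t : ℝ) : ℂ := ⟨Real.cos (Real.pi * t), ε * Real.sin (Real.pi * t)⟩

/-- Position of the `k`-th point at time `t` of the half-twist: the `i`-th and the `j`-th point
change places counterclockwise on the ellipse of thickness `ε` around the segment joining them, the
other points rest. -/
def twistMotion {n : ℕ} (p : Fin n → ℂ) (i j : Fin n) (ε t : ℝ) (k : Fin n) : ℂ :=
  if k = i then (p i + p j) / 2 - (p j - p i) / 2 * ellipseArc ε t
  else if k = j then (p i + p j) / 2 + (p j - p i) / 2 * ellipseArc ε t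
  else p k

theorem ellipse_mem_twistNhd (a b : ℂ) (ε t : ℝ) :
    (a + b) / 2 + (b - a) / 2 * ellipseArc ε t ∈ twistNhd a b ε ∧
    (a + b) / 2 - (b - a) / 2 * ellipseArc ε t ∈ twistNhd a b ε := by
  have key : ∀ c s : ℝ, c ^ 2 + s ^ 2 = 1 → (⟨c, s⟩ : ℂ) ∈ Metric.closedBall (0 : ℂ) 1 := by
    intro c s h
    rw [mem_closedBall_zero_iff, ← sq_le_one_iff₀ (norm_nonneg _), Complex.sq_norm,
      Complex.normSq_mk]
    nlinarith
  refine ⟨⟨⟨Real.cos (Real.pi * t), Real.sin (Real.pi * t)⟩, key _ _ (Real.cos_sq_add_sin_sq _),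
    rfl⟩, ⟨⟨-Real.cos (Real.pi * t), -Real.sin (Real.pi * t)⟩, key _ _ ?_, ?_⟩⟩
  · simp [Real.cos_sq_add_sin_sq]
  · have : (⟨-Real.cos (Real.pi * t), ε * -Real.sin (Real.pi * t)⟩ : ℂ) = -ellipseArc ε t := by
      apply Complex.ext <;> simp [ellipseArc]
    simp only [this]
    ring

theorem ellipseArc_ne_zero {ε : ℝ} (hε : 0 < ε) (t : ℝ) : ellipseArc ε t ≠ 0 := by
  intro h
  have h1 : Real.cos (Real.pi * t) = 0 := by simpa [ellipseArc] using congrArg Complex.re h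
  have h2 : ε * Real.sin (Real.pi * t) = 0 := by simpa [ellipseArc] using congrArg Complex.im h
  have h3 : Real.sin (Real.pi * t) = 0 := by
    rcases mul_eq_zero.1 h2 with h | h
    · exact absurd h hε.ne'
    · exact h
  have := Real.cos_sq_add_sin_sq (Real.pi * t)
  rw [h1, h3] at this
  norm_num at this

theorem twistMotion_conf {U : Set ℂ} {n : ℕ} (p : OConf U n) {i j : Fin n} (hij : i ≠ j) {ε : ℝ}
    (h : p.Admissible i j ε) (t : ℝ) :
    Function.Injective (twistMotion p.1 i j ε t) ∧ ∀ k, twistMotion p.1 i j ε t k ∈ U := by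
  obtain ⟨m1, m2⟩ := ellipse_mem_twistNhd (p.1 i) (p.1 j) ε t
  have h1 := h.2 m1
  have h2 := h.2 m2
  have hw := ellipseArc_ne_zero h.1 t
  have hv : p.1 j - p.1 i ≠ 0 := sub_ne_zero.2 fun e => hij (p.2.1 e).symm
  have hpm : (p.1 i + p.1 j) / 2 - (p.1 j - p.1 i) / 2 * ellipseArc ε t ≠
      (p.1 i + p.1 j) / 2 + (p.1 j - p.1 i) / 2 * ellipseArc ε t := by
    intro e
    have : (p.1 j - p.1 i) * ellipseArc ε t = 0 := by linear_combination -e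
    exact (mul_ne_zero hv hw) this
  have o1 : ∀ k, k ≠ i → k ≠ j →
      (p.1 i + p.1 j) / 2 + (p.1 j - p.1 i) / 2 * ellipseArc ε t ≠ p.1 k :=
    fun k ki kj e => h1.2 ⟨k, ⟨ki, kj⟩, e.symm⟩
  have o2 : ∀ k, k ≠ i → k ≠ j →
      (p.1 i + p.1 j) / 2 - (p.1 j - p.1 i) / 2 * ellipseArc ε t ≠ p.1 k :=
    fun k ki kj e => h2.2 ⟨k, ⟨ki, kj⟩, e.symm⟩
  constructor
  · intro k l hkl
    unfold twistMotion at hkl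
    split_ifs at hkl with a1 a2 a3 a4 a5 a6 a7 a8
    · rw [a1, a2]
    · exact absurd hkl hpm
    · exact absurd hkl (o2 _ a2 a3)
    · exact absurd hkl.symm hpm
    · rw [a4, a6]
    · exact absurd hkl (o1 _ a5 a6)
    · exact absurd hkl.symm (o2 _ a1 a4)
    · exact absurd hkl.symm (o1 _ a1 a4)
    · exact p.2.1 hkl
  · intro k
    unfold twistMotion
    split_ifs
    · exact h2.1
    · exact h1.1
    · exact p.2.2 k

/-- The motion of the half-twist, as a loop of `n`-point sets. -/
def halfTwistLoop {U : Set ℂ} {n : ℕ} (p : OConf U n) {i j : Fin n} (hij : i ≠ j) {ε : ℝ}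
    (h : p.Admissible i j ε) : Path p.forget p.forget where
  toFun t := OConf.forget ⟨twistMotion p.1 i j ε t, twistMotion_conf p hij h t⟩
  continuous_toFun := by
    refine OConf.continuous_forget.comp (Continuous.subtype_mk (continuous_pi fun k => ?_) _)
    have hc : Continuous fun t : unitInterval => ellipseArc ε (t : ℝ) := by
      have : (fun t : unitInterval => ellipseArc ε (t : ℝ)) = fun t : unitInterval =>
          ((Real.cos (Real.pi * t) : ℝ) : ℂ) + ((ε * Real.sin (Real.pi * t) : ℝ) : ℂ) *
            Complex.I := by
        funext t
        exact Complex.mk_eq_add_mul_I _ _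
      rw [this]
      fun_prop
    unfold twistMotion
    split_ifs <;> fun_prop
  source' := by
    congr 1
    apply Subtype.ext
    funext k
    have e : ellipseArc ε 0 = 1 := by apply Complex.ext <;> simp [ellipseArc]
    simp only [twistMotion, Set.Icc.coe_zero, e]
    split_ifs with a b
    · rw [a]; ring
    · rw [b]; ring
    · rfl
  target' := by
    apply Subtype.ext
    have e : ellipseArc ε 1 = -1 := by apply Complex.ext <;> simp [ellipseArc]
    have hm : twistMotion p.1 i j ε 1 = p.1 ∘ Equiv.swap i j := by
      funext k
      simp only [twistMotion, e, Function.comp]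
      split_ifs with a b
      · rw [a, Equiv.swap_apply_left]; ring
      · rw [b, Equiv.swap_apply_right]; ring
      · rw [Equiv.swap_apply_of_ne_of_ne a b]
    simp only [OConf.forget, Set.Icc.coe_one, hm]
    exact (Equiv.swap i j).surjective.range_comp p.1

/-- A thin enough neighbourhood exists, if the other points are not on the segment. -/
theorem exists_admissible {U : Set ℂ} (hU : IsOpen U) (hUc : Convex ℝ U) {n : ℕ} (p : OConf U n)
    {i j : Fin n} (h : ∀ k, k ≠ i → k ≠ j → p.1 k ∉ segment ℝ (p.1 i) (p.1 j)) :
    ∃ ε, p.Admissible i j ε := by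
  set O : Set ℂ := U \ p.1 '' {k | k ≠ i ∧ k ≠ j} with hO
  have hOo : IsOpen O := hU.sdiff (Set.toFinite _).isClosed
  let Φ : ℝ × ℂ → ℂ := fun q =>
    (p.1 i + p.1 j) / 2 + (p.1 j - p.1 i) / 2 * ((q.2.re : ℂ) + ((q.1 * q.2.im : ℝ) : ℂ) *
      Complex.I)
  have hΦ : Continuous Φ := by
    have h1 : Continuous fun q : ℝ × ℂ => q.2.re := Complex.continuous_re.comp continuous_snd
    have h2 : Continuous fun q : ℝ × ℂ => q.2.im := Complex.continuous_im.comp continuous_snd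
    fun_prop
  have hsub : ({0} : Set ℝ) ×ˢ Metric.closedBall (0 : ℂ) 1 ⊆ Φ ⁻¹' O := by
    rintro ⟨e, w⟩ ⟨he, hw⟩
    obtain rfl : e = 0 := he
    have hwre : |w.re| ≤ 1 := (Complex.abs_re_le_norm w).trans (by simpa using hw)
    obtain ⟨l1, l2⟩ := abs_le.1 hwre
    have hseg : Φ (0, w) ∈ segment ℝ (p.1 i) (p.1 j) := by
      refine ⟨(1 - w.re) / 2, (1 + w.re) / 2, by linarith, by linarith, by ring, ?_⟩
      simp only [Φ, Complex.real_smul]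
      push_cast
      ring
    refine ⟨hUc.segment_subset (p.2.2 i) (p.2.2 j) hseg, ?_⟩
    rintro ⟨k, ⟨hki, hkj⟩, hk⟩
    exact h k hki hkj (hk ▸ hseg)
  obtain ⟨u, v, huo, -, h0u, hv, huv⟩ := generalized_tube_lemma isCompact_singleton
    (isCompact_closedBall (0 : ℂ) 1) (hOo.preimage hΦ) hsub
  obtain ⟨δ, hδ, hball⟩ := Metric.isOpen_iff.1 huo 0 (h0u rfl)
  refine ⟨δ / 2, by linarith, ?_⟩
  rintro _ ⟨w, hw, rfl⟩
  have hmem : (δ / 2, w) ∈ u ×ˢ v := by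
    refine ⟨hball ?_, hv hw⟩
    rw [Metric.mem_ball, Real.dist_eq, sub_zero, abs_of_pos (by linarith)]
    linarith
  have := huv hmem
  have e : Φ (δ / 2, w) = (p.1 i + p.1 j) / 2 + (p.1 j - p.1 i) / 2 *
      (⟨w.re, δ / 2 * w.im⟩ : ℂ) := by
    simp only [Φ]
    rw [← Complex.mk_eq_add_mul_I]
  rw [Set.mem_preimage, e] at this
  exact this

/-! ### The Artin generators -/

/-- The order in which a set of points is read from left to right in the projection to the real
axis: by real part, and by imaginary part where real parts agree (that is, by real part after a
clockwise rotation by a very small angle). -/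
def lexPair : ℂ ↪ ℝ ×ₗ ℝ where
  toFun z := toLex (z.re, z.im)
  inj' z w h := by
    have : (z.re, z.im) = (w.re, w.im) := toLex.injective h
    exact Complex.ext (congrArg Prod.fst this) (congrArg Prod.snd this)

theorem UConf.finite {U : Set ℂ} {n : ℕ} (s : UConf U n) : s.1.Finite :=
  Set.finite_of_encard_eq_coe s.2.2

theorem UConf.card_lex {U : Set ℂ} {n : ℕ} (s : UConf U n) :
    (s.finite.toFinset.map lexPair).card = n := by
  rw [Finset.card_map]
  have := s.2.2
  rw [s.finite.encard_eq_coe_toFinset_card] at this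
  exact_mod_cast this

theorem UConf.exists_strand {U : Set ℂ} {n : ℕ} (s : UConf U n) (k : Fin n) :
    ∃ z ∈ s.1, lexPair z = (s.finite.toFinset.map lexPair).orderEmbOfFin s.card_lex k := by
  have := Finset.orderEmbOfFin_mem (s.finite.toFinset.map lexPair) s.card_lex k
  obtain ⟨z, hz, h⟩ := Finset.mem_map.1 this
  exact ⟨z, by simpa using hz, h⟩

/-- The `k`-th point (`k = 0, …, n - 1`) of the set `s`, from left to right. -/
def UConf.strand {U : Set ℂ} {n : ℕ} (s : UConf U n) (k : Fin n) : ℂ :=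
  (s.exists_strand k).choose

theorem UConf.strand_mem {U : Set ℂ} {n : ℕ} (s : UConf U n) (k : Fin n) : s.strand k ∈ s.1 :=
  (s.exists_strand k).choose_spec.1

theorem UConf.strand_lt {U : Set ℂ} {n : ℕ} (s : UConf U n) {k l : Fin n} :
    lexPair (s.strand k) < lexPair (s.strand l) ↔ k < l := by
  have hk : lexPair (s.strand k) = _ := (s.exists_strand k).choose_spec.2
  have hl : lexPair (s.strand l) = _ := (s.exists_strand l).choose_spec.2
  rw [hk, hl, OrderEmbedding.lt_iff_lt]

/-- The points of `s` listed from left to right. -/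
def UConf.sorted {U : Set ℂ} {n : ℕ} (s : UConf U n) : OConf U n :=
  ⟨s.strand, fun k l h => by
    by_contra hne
    rcases lt_or_gt_of_ne hne with hlt | hlt
    · exact absurd (congrArg lexPair h) (s.strand_lt.2 hlt).ne
    · exact absurd (congrArg lexPair h) (s.strand_lt.2 hlt).ne', fun k => s.2.1 (s.strand_mem k)⟩

theorem UConf.forget_sorted {U : Set ℂ} {n : ℕ} (s : UConf U n) : s.sorted.forget = s := by
  apply Subtype.ext
  refine s.finite.eq_of_subset_of_encard_le' ?_ ?_
  · rintro _ ⟨k, rfl⟩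
    exact s.strand_mem k
  · rw [s.2.2, s.sorted.forget.2.2]

/-- No other point lies on the segment between two consecutive ones. -/
theorem UConf.sorted_segment {U : Set ℂ} {n : ℕ} (s : UConf U n) (i : ℕ) (hi : i + 1 < n) :
    ∀ k : Fin n, k ≠ ⟨i, by omega⟩ → k ≠ ⟨i + 1, hi⟩ →
      s.sorted.1 k ∉ segment ℝ (s.sorted.1 ⟨i, by omega⟩) (s.sorted.1 ⟨i + 1, hi⟩) := by
  intro k hk1 hk2
  change s.strand k ∉ segment ℝ (s.strand _) (s.strand _)
  have lexlt : ∀ z w : ℂ, lexPair z < lexPair w ↔ z.re < w.re ∨ z.re = w.re ∧ z.im < w.im :=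
    fun z w => Prod.Lex.toLex_lt_toLex
  have hab : lexPair (s.strand ⟨i, by omega⟩) < lexPair (s.strand ⟨i + 1, hi⟩) :=
    s.strand_lt.2 (by simp [Fin.lt_def])
  have hout : lexPair (s.strand k) < lexPair (s.strand ⟨i, by omega⟩) ∨
      lexPair (s.strand ⟨i + 1, hi⟩) < lexPair (s.strand k) := by
    rw [s.strand_lt, s.strand_lt, Fin.lt_def, Fin.lt_def]
    have h1 : (k : ℕ) ≠ i := fun e => hk1 (Fin.ext e)
    have h2 : (k : ℕ) ≠ i + 1 := fun e => hk2 (Fin.ext e)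
    dsimp only
    omega
  rintro ⟨x, y, hx, hy, hxy, he⟩
  rw [← he] at hout
  rw [lexlt] at hab
  rw [lexlt, lexlt] at hout
  generalize s.strand ⟨i, _⟩ = a at *
  generalize s.strand ⟨i + 1, hi⟩ = b at *
  simp only [Complex.add_re, Complex.add_im, Complex.real_smul, Complex.re_ofReal_mul,
    Complex.im_ofReal_mul] at hout
  obtain rfl : x = 1 - y := by linarith
  rcases hab with hab | ⟨h1, h2⟩
  · rcases hout with (h | ⟨h, h'⟩) | (h | ⟨h, h'⟩)
    · nlinarith
    · have : y * (b.re - a.re) = 0 := by linarith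
      rcases mul_eq_zero.1 this with h0 | h0
      · subst h0; linarith
      · linarith
    · nlinarith
    · have : (1 - y) * (b.re - a.re) = 0 := by linarith
      rcases mul_eq_zero.1 this with h0 | h0
      · obtain rfl : y = 1 := by linarith
        linarith
      · linarith
  · rw [h1] at hout
    rcases hout with (h | ⟨h, h'⟩) | (h | ⟨h, h'⟩) <;> nlinarith

/-- The Artin generator `σ_{i+1}` (`0 ≤ i < n - 1`) of the braid group based at `s`: the positive
half-twist along the segment joining the `(i+1)`-st and the `(i+2)`-nd point of `s`, the points
being counted from left to right. The thickness of the elliptical neighbourhood in which the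
half-twist takes place does not change the homotopy class. -/
def artinGen {U : Set ℂ} (hU : IsOpen U) (hUc : Convex ℝ U) {n : ℕ} (s : UConf U n)
    (i : ℕ) (hi : i + 1 < n) : BraidGroup U n s :=
  FundamentalGroup.fromPath (Path.Homotopic.Quotient.mk
    ((halfTwistLoop s.sorted (i := ⟨i, by omega⟩) (j := ⟨i + 1, hi⟩)
      (fun e => by simp at e)
      (exists_admissible hU hUc s.sorted (s.sorted_segment i hi)).choose_spec).cast
        s.forget_sorted.symm s.forget_sorted.symm))

/-! ### Braid monodromy of a plane curve -/

/-- `K(x)`: the second coordinates of the points over `x` of the curve `F = 0`, where `F(x, y)` is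
a polynomial in `y` with coefficients in `ℂ[x]`. -/
def fibre (F : ℂ[X][X]) (x : ℂ) : Set ℂ := {y | F.evalEval x y = 0}

/-- `N`: the `x` over which the curve has fewer than `n` points, `n` being the degree in `y`
(a vertical line in the curve counts as degenerate as well; otherwise there are at most `n`). -/
def branchSet (F : ℂ[X][X]) : Set ℂ := {x | (fibre F x).encard ≠ F.natDegree}

/-- The point set `K(x)` as a configuration, for `x ∈ E \ N`. -/
def fibreConf (F : ℂ[X][X]) {E U : Set ℂ} (hEU : ∀ x ∈ E, fibre F x ⊆ U)
    (x : ↥(E \ branchSet F)) : UConf U F.natDegree :=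
  ⟨fibre F x, hEU x x.2.1, not_not.1 x.2.2⟩

theorem contDiff_evalEval (F : ℂ[X][X]) {m : ℕ} :
    ContDiff ℂ m (fun q : ℂ × ℂ => F.evalEval q.1 q.2) := by
  have : (fun q : ℂ × ℂ => F.evalEval q.1 q.2) = fun q : ℂ × ℂ =>
      ∑ k ∈ Finset.range (F.natDegree + 1), (F.coeff k).aeval q.1 * q.2 ^ k := by
    funext q
    rw [evalEval, eval_eq_sum_range (p := F), eval_finsetSum]
    simp
  rw [this]
  refine ContDiff.sum fun k _ => ?_
  exact ((F.coeff k).contDiff_aeval (𝕜 := ℂ) m |>.comp contDiff_fst).mul (contDiff_snd.pow k)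

/-- Away from `N` the fibre points are simple roots. -/
theorem simple_root (F : ℂ[X][X]) {x y : ℂ} (hx : x ∉ branchSet F) (hy : y ∈ fibre F x) :
    (F.map (evalRingHom x)).derivative.eval y ≠ 0 := by
  set f := F.map (evalRingHom x) with hf
  have hev : ∀ z, F.evalEval x z = f.eval z := fun z => by
    rw [hf, eval_map, eval₂_evalRingHom]
  have henc : (fibre F x).encard = F.natDegree := not_not.1 hx
  have hf0 : f ≠ 0 := by
    intro h0
    have : fibre F x = Set.univ := by
      ext z
      simp [fibre, hev, h0]
    rw [this, Set.encard_univ, ENat.card_eq_top_of_infinite] at henc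
    exact ENat.top_ne_natCast _ henc
  have hset : fibre F x = (f.roots.toFinset : Set ℂ) := by
    ext z
    simp [fibre, hev, hf0]
  have hcard : f.roots.toFinset.card = F.natDegree := by
    rw [hset, Set.encard_coe_eq_coe_finsetCard] at henc
    exact_mod_cast henc
  have hle : f.roots.card ≤ f.roots.toFinset.card := by
    rw [hcard]
    exact (card_roots' f).trans natDegree_map_le
  have hnd : f.roots.Nodup := by
    rw [← Multiset.dedup_card_eq_card_iff_nodup]
    exact le_antisymm (Multiset.card_le_card (Multiset.dedup_le _)) hle
  have hroot : f.IsRoot y := by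
    have : F.evalEval x y = 0 := hy
    rwa [hev] at this
  intro hd
  have h1 : 1 < f.rootMultiplicity y := (one_lt_rootMultiplicity_iff_isRoot hf0).2 ⟨hroot, hd⟩
  rw [← count_roots] at h1
  exact absurd (Multiset.nodup_iff_count_le_one.1 hnd y) (by omega)

/-- Each fibre point away from `N` moves continuously. -/
theorem exists_local_root (F : ℂ[X][X]) {x y : ℂ} (hx : x ∉ branchSet F) (hy : y ∈ fibre F x) :
    ∃ g : ℂ → ℂ, ContinuousAt g x ∧ g x = y ∧ ∀ᶠ z in nhds x, g z ∈ fibre F z := by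
  have hc : ContDiffAt ℂ (1 : ℕ) (fun q : ℂ × ℂ => F.evalEval q.1 q.2) (x, y) :=
    (contDiff_evalEval F).contDiffAt
  have hs := hc.hasStrictFDerivAt (by norm_num)
  set L := fderiv ℂ (fun q : ℂ × ℂ => F.evalEval q.1 q.2) (x, y) ∘L .inr ℂ ℂ ℂ with hL
  have hd1 : HasFDerivAt (fun z : ℂ => F.evalEval x z) L y :=
    HasFDerivAt.comp y (f := fun z : ℂ => (x, z)) hs.hasFDerivAt (hasFDerivAt_prodMk_right x y)
  have hd2 : HasDerivAt (fun z : ℂ => F.evalEval x z)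
      ((F.map (evalRingHom x)).derivative.eval y) y := by
    have : (fun z : ℂ => F.evalEval x z) = fun z => (F.map (evalRingHom x)).eval z := by
      funext z
      rw [eval_map, eval₂_evalRingHom]
    rw [this]
    exact (F.map (evalRingHom x)).hasDerivAt y
  have hL1 : L 1 = (F.map (evalRingHom x)).derivative.eval y :=
    hd1.hasDerivAt.unique hd2
  have hL0 : L 1 ≠ 0 := by
    rw [hL1]
    exact simple_root F hx hy
  have hinv : L.IsInvertible := by
    refine ⟨ContinuousLinearEquiv.unitsEquivAut ℂ (Units.mk0 _ hL0), ?_⟩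
    ext
    simp
  refine ⟨hs.implicitFunctionOfProdDomain hinv, ?_, ?_, ?_⟩
  · exact (hs.hasStrictFDerivAt_implicitFunctionOfProdDomain hinv).continuousAt
  · exact (hs.eventually_apply_eq_iff_implicitFunctionOfProdDomain hinv).self_of_nhds.mp rfl
  · filter_upwards [hs.eventually_apply_implicitFunctionOfProdDomain hinv] with z hz
    exact hz.trans hy

theorem continuous_fibreConf (F : ℂ[X][X]) {E U : Set ℂ} (hEU : ∀ x ∈ E, fibre F x ⊆ U) :
    Continuous (fibreConf F hEU) := by
  rw [continuous_iff_continuousAt]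
  intro x
  set s := fibreConf F hEU x with hs
  have hmem : ∀ k, s.strand k ∈ fibre F x := fun k => s.strand_mem k
  choose g hgc hgx hgF using fun k => exists_local_root F x.2.2 (hmem k)
  intro V hV
  obtain ⟨V', hV'V, hV'o, hsV'⟩ := mem_nhds_iff.1 hV
  have hpre : IsOpen (OConf.forget ⁻¹' V' : Set (OConf U F.natDegree)) :=
    hV'o.preimage OConf.continuous_forget
  obtain ⟨W, hWo, hW⟩ := isOpen_induced_iff.1 hpre
  have hsW : s.strand ∈ W := by
    have : s.sorted ∈ OConf.forget ⁻¹' V' := by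
      rw [Set.mem_preimage, s.forget_sorted]
      exact hsV'
    rw [← hW] at this
    exact this
  have hG : ContinuousAt (fun z k => g k z) (x : ℂ) := continuousAt_pi.2 hgc
  have hGx : (fun k => g k (x : ℂ)) = s.strand := funext hgx
  have e1 : ∀ᶠ z in nhds (x : ℂ), (fun k => g k z) ∈ W :=
    hG.eventually_mem (by rw [hGx]; exact hWo.mem_nhds hsW)
  have e2 : ∀ᶠ z in nhds (x : ℂ), ∀ k l, k ≠ l → g k z ≠ g l z := by
    rw [Filter.eventually_all]
    intro k
    rw [Filter.eventually_all]
    intro l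
    by_cases hkl : k = l
    · exact Filter.Eventually.of_forall fun z h => absurd hkl h
    · have : g k x ≠ g l x := by
        rw [hgx, hgx]
        exact fun e => hkl (s.sorted.2.1 e)
      exact ((hgc k).ne_iff_eventually_ne (hgc l)).1 this |>.mono fun z hz _ => hz
  have e3 : ∀ᶠ z in nhds (x : ℂ), ∀ k, g k z ∈ fibre F z := Filter.eventually_all.2 hgF
  have e : ∀ᶠ z in nhds (x : ℂ), (fun k => g k z) ∈ W ∧ (∀ k l, k ≠ l → g k z ≠ g l z) ∧
      ∀ k, g k z ∈ fibre F z := e1.and (e2.and e3)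
  have e' := (continuous_subtype_val.continuousAt (x := x)).eventually e
  refine Filter.mem_map.2 (e'.mono fun z hz => hV'V ?_)
  obtain ⟨z1, z2, z3⟩ := hz
  let q : OConf U F.natDegree := ⟨fun k => g k z, fun k l h => by
    by_contra hne
    exact z2 k l hne h, fun k => hEU z z.2.1 (z3 k)⟩
  have hq : q.forget = fibreConf F hEU z := by
    apply Subtype.ext
    refine (fibreConf F hEU z).finite.eq_of_subset_of_encard_le' ?_ ?_
    · rintro _ ⟨k, rfl⟩
      exact z3 k
    · rw [(fibreConf F hEU z).2.2, q.forget.2.2]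
  rw [← hq]
  have : q ∈ (Subtype.val ⁻¹' W : Set (OConf U F.natDegree)) := z1
  rw [hW] at this
  exact this

/-- The braid monodromy `φ : π₁(E \ N, M) → B_n` of the curve `F = 0` with respect to `E × U`, the
first projection and `M`. A loop `γ` in `E \ N` goes to the class of the motion `t ↦ K(γ(t))`, whose
strings are the second coordinates of the `n` lifts of `γ` to the curve. -/
def braidMonodromy (F : ℂ[X][X]) {E U : Set ℂ} (hEU : ∀ x ∈ E, fibre F x ⊆ U)
    (M : ↥(E \ branchSet F)) :
    FundamentalGroup ↥(E \ branchSet F) M →* BraidGroup U F.natDegree (fibreConf F hEU M) :=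
  FundamentalGroup.map ⟨fibreConf F hEU, continuous_fibreConf F hEU⟩ M

/-- The circle around `0` through `M`, once counterclockwise, as a loop in `E \ N`, where `E` is
the closed disc of radius `r = |M|` around `0` and `N ∩ E ⊆ {0}`. -/
def circleLoop (F : ℂ[X][X]) {r : ℝ} (hr : 0 < r)
    (hN : ∀ x ∈ Metric.closedBall (0 : ℂ) r, x ∈ branchSet F → x = 0)
    (M : ↥(Metric.closedBall (0 : ℂ) r \ branchSet F)) (hM : (M : ℂ) ∈ Metric.sphere (0 : ℂ) r) :
    Path M M where
  toFun t := ⟨M * Complex.exp (2 * Real.pi * t * Complex.I), by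
    have hn : ‖(M : ℂ) * Complex.exp (2 * Real.pi * (t : ℝ) * Complex.I)‖ = r := by
      have : (2 * Real.pi * (t : ℝ) * Complex.I : ℂ) = ((2 * Real.pi * t : ℝ) : ℂ) * Complex.I := by
        push_cast; ring
      rw [norm_mul, this, Complex.norm_exp_ofReal_mul_I, mul_one]
      simpa using hM
    have hmem : (M : ℂ) * Complex.exp (2 * Real.pi * (t : ℝ) * Complex.I) ∈
        Metric.closedBall (0 : ℂ) r := by
      rw [mem_closedBall_zero_iff, hn]
    refine ⟨hmem, fun h => ?_⟩
    rw [hN _ hmem h, norm_zero] at hn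
    exact hr.ne hn⟩
  continuous_toFun := by fun_prop
  source' := by simp
  target' := by simp

/-! ### Two cusps meeting at a point -/

/-- The curve `(y² + x³)(y² - x³) = 0`. -/
def twoCusps : ℂ[X][X] := (X ^ 2 + C (X ^ 3)) * (X ^ 2 - C (X ^ 3))

theorem natDegree_twoCusps : twoCusps.natDegree = 4 := by
  have h1 : (X ^ 2 + C (X ^ 3) : ℂ[X][X]).natDegree = 2 := natDegree_X_pow_add_C
  have h2 : (X ^ 2 - C (X ^ 3) : ℂ[X][X]).natDegree = 2 := natDegree_X_pow_sub_C
  rw [twoCusps, natDegree_mul, h1, h2]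
  · intro h; rw [h] at h1; simp at h1
  · intro h; rw [h] at h2; simp at h2

theorem mem_fibre_twoCusps (x y : ℂ) :
    y ∈ fibre twoCusps x ↔ (y ^ 2 + x ^ 3) * (y ^ 2 - x ^ 3) = 0 := by
  simp [fibre, twoCusps, evalEval]

/-- The origin is the only point of `N`. -/
theorem branchSet_twoCusps : branchSet twoCusps = {0} := by
  ext x
  rw [branchSet, Set.mem_ofPred_eq, natDegree_twoCusps, Set.mem_singleton_iff]
  constructor
  · intro h
    by_contra hx
    apply h
    obtain ⟨w, hw⟩ := IsAlgClosed.exists_pow_nat_eq x (n := 2) (by norm_num)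
    have hw0 : w ≠ 0 := by rintro rfl; exact hx (by rw [← hw]; norm_num)
    have h3 : w ^ 3 ≠ 0 := pow_ne_zero _ hw0
    have hfin : fibre twoCusps x = (({w ^ 3, -w ^ 3, Complex.I * w ^ 3, -(Complex.I * w ^ 3)} :
        Finset ℂ) : Set ℂ) := by
      ext y
      rw [mem_fibre_twoCusps, ← hw]
      simp only [Finset.coe_insert, Finset.coe_singleton, Set.mem_insert_iff,
        Set.mem_singleton_iff]
      have : (y ^ 2 + (w ^ 2) ^ 3) * (y ^ 2 - (w ^ 2) ^ 3) =
          (y - w ^ 3) * (y + w ^ 3) * (y - Complex.I * w ^ 3) * (y + Complex.I * w ^ 3) := by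
        linear_combination (w ^ 6 * (y ^ 2 - w ^ 6)) * Complex.I_sq
      rw [this]
      simp only [mul_eq_zero, sub_eq_zero, add_eq_zero_iff_eq_neg, or_assoc]
    rw [hfin, Set.encard_coe_eq_coe_finsetCard]
    have a1 : (w ^ 3) ≠ -w ^ 3 := fun h => h3 (by linear_combination h / 2)
    have n1 : (1 - Complex.I) ≠ 0 := fun h => by simpa using congrArg Complex.re h
    have n2 : (1 + Complex.I) ≠ 0 := fun h => by simpa using congrArg Complex.re h
    have a2 : (w ^ 3) ≠ Complex.I * w ^ 3 := fun h =>
      mul_ne_zero n1 h3 (by linear_combination h)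
    have a3 : (w ^ 3) ≠ -(Complex.I * w ^ 3) := fun h =>
      mul_ne_zero n2 h3 (by linear_combination h)
    have a4 : (-w ^ 3) ≠ Complex.I * w ^ 3 := fun h =>
      mul_ne_zero n2 h3 (by linear_combination -h)
    have a5 : (-w ^ 3) ≠ -(Complex.I * w ^ 3) := fun h =>
      mul_ne_zero n1 h3 (by linear_combination -h)
    have a6 : (Complex.I * w ^ 3) ≠ -(Complex.I * w ^ 3) := fun h =>
      mul_ne_zero Complex.I_ne_zero h3 (by linear_combination h / 2)
    rw [Finset.card_insert_of_notMem (by simp only [Finset.mem_insert, Finset.mem_singleton]; tauto),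
      Finset.card_insert_of_notMem (by simp only [Finset.mem_insert, Finset.mem_singleton]; tauto),
      Finset.card_insert_of_notMem (by simp only [Finset.mem_singleton]; tauto),
      Finset.card_singleton]
  · rintro rfl
    have : fibre twoCusps 0 = {0} := by
      ext y
      rw [mem_fibre_twoCusps]
      simp
    rw [this, Set.encard_singleton]
    norm_num

theorem branchSet_twoCusps_disc (r : ℝ) :
    ∀ x ∈ Metric.closedBall (0 : ℂ) r, x ∈ branchSet twoCusps → x = 0 := by
  intro x _ h
  rwa [branchSet_twoCusps] at h

end BraidMonodromy

end

noncomputable section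

namespace BraidMonodromy

open unitInterval

/-! ### Paths factoring through a simply connected space -/

section Lift

variable {Z X : Type*} [TopologicalSpace Z] [TopologicalSpace X] [SimplyConnectedSpace Z]

/-! The curve is quasi-homogeneous: (x, y) ↦ (e^{2θ}x, e^{3θ}y) preserves it
(`exp_mul_mem_fibre_twoCusps`). Hence the fibre over M e^{2πit} is e^{3πit}K(M), and the braid of Γ
is the rigid rotation of K(M) by three half-turns, each of them a loop because K(M) = -K(M). The
core is that one half-turn equals (σ₂σ₁σ₃)² (`rotLoop_one_eq`).

No presentation of the braid group is used. Fix a slightly tilted direction in which the points are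
strictly ordered from left to right, and a configuration q stacked vertically with respect to it.
Each numbering τ of the points gives a class `fanClass τ` of paths to q, moving all points straight
to their places. If during a numbered motion no point gets straight below one of smaller number, the
straight motions to q exist at all times without collision and sweep out a square; so the motion
followed by its final fan is homotopic to its initial fan (`mk_trans_straightPath`). This applies to
the half-turn, which leads from the identity numbering to the reversed one
(`rotLoop_trans_fanClass`), and to a half-twist of neighbours whose numbers still increase from left
to right (`artinGen_trans_fanClass`). The six-letter word reaches the reversal by such exchanges
only, so it and the half-turn both equal the fan of the identity followed by the inverse fan of the
reversal.

For the image of φ it remains that Γ generates the fundamental group of the punctured disc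
(`zpowers_windLoop`); this follows by lifting loops through the exponential to a half-plane. -/

/-- Two paths that are images of paths in a simply connected space with common endpoints are
homotopic. -/
theorem mk_eq_of_lift (Q : C(Z, X)) {a b : Z} {x y : X} (g g' : Path a b) (p p' : Path x y)
    (hp : ∀ t, p t = Q (g t)) (hp' : ∀ t, p' t = Q (g' t)) :
    Path.Homotopic.Quotient.mk p = Path.Homotopic.Quotient.mk p' := by
  obtain rfl : Q a = x := by rw [← p.source, hp, g.source]
  obtain rfl : Q b = y := by rw [← p.target, hp, g.target]
  have e : p = g.map Q.continuous := by ext t; exact hp t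
  have e' : p' = g'.map Q.continuous := by ext t; exact hp' t
  rw [e, e', Path.Homotopic.Quotient.eq]
  exact (SimplyConnectedSpace.paths_homotopic g g').map Q

/-- The composition of two paths that factor through a simply connected space. -/
theorem trans_eq_of_lift (Q : C(Z, X)) {a b c : Z} {x y z : X} (g : Path a b) (g' : Path b c)
    (g'' : Path a c) (p : Path x y) (p' : Path y z) (p'' : Path x z)
    (hp : ∀ t, p t = Q (g t)) (hp' : ∀ t, p' t = Q (g' t)) (hp'' : ∀ t, p'' t = Q (g'' t)) :
    (Path.Homotopic.Quotient.mk p).trans (Path.Homotopic.Quotient.mk p') =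
      Path.Homotopic.Quotient.mk p'' := by
  rw [← Path.Homotopic.Quotient.mk_trans]
  refine mk_eq_of_lift Q (g.trans g') g'' _ _ (fun t => ?_) hp''
  simp only [Path.trans_apply]
  split_ifs
  · exact hp _
  · exact hp' _

end Lift

/-- The side `t ↦ (t, s)` of the unit square. -/
def sqHor (s : I) : Path ((0, s) : I × I) (1, s) where
  toFun t := (t, s)
  source' := rfl
  target' := rfl

/-- The side `s ↦ (t, s)` of the unit square. -/
def sqVer (t : I) : Path ((t, 0) : I × I) (t, 1) where
  toFun s := (t, s)
  source' := rfl
  target' := rfl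

instance : ContractibleSpace I :=
  (convex_Icc (0 : ℝ) 1).contractibleSpace ⟨0, by simp⟩

/-- A map of the unit square whose upper side is constant. -/
theorem mk_trans_eq_of_square {X : Type*} [TopologicalSpace X] (H : C(I × I, X)) {x y z : X}
    (p : Path x y) (l : Path x z) (r : Path y z) (hp : ∀ t, p t = H (t, 0))
    (hl : ∀ s, l s = H (0, s)) (hr : ∀ s, r s = H (1, s)) (ht : ∀ t, H (t, 1) = z) :
    (Path.Homotopic.Quotient.mk p).trans (Path.Homotopic.Quotient.mk r) =
      Path.Homotopic.Quotient.mk l := by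
  -- Appending a constant path to `l` makes both sides images of paths between opposite corners of
  -- the square.
  rw [← Path.Homotopic.Quotient.trans_refl (Path.Homotopic.Quotient.mk l),
    ← Path.Homotopic.Quotient.mk_refl, ← Path.Homotopic.Quotient.mk_trans,
    ← Path.Homotopic.Quotient.mk_trans]
  refine mk_eq_of_lift H ((sqHor 0).trans (sqVer 1)) ((sqVer 0).trans (sqHor 1)) _ _
    (fun t => ?_) (fun t => ?_)
  · simp only [Path.trans_apply]
    split_ifs
    · exact hp _
    · exact hr _
  · simp only [Path.trans_apply]
    split_ifs
    · exact hl _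
    · exact (ht _).symm

/-! ### Straight motions to a tilted vertical configuration -/

section Straight

variable {U : Set ℂ} {n : ℕ}

/-- In the coordinates turned by `1 - κ I`, no point is straight above one of larger index. -/
def Unobstructed (κ : ℝ) (x : Fin n → ℂ) : Prop :=
  ∀ a b, a < b → ((x b - x a) * (1 - κ * Complex.I)).re ≠ 0 ∨
    0 < ((x b - x a) * (1 - κ * Complex.I)).im

/-- In the coordinates turned by `1 - κ I`, each point is straight above those of smaller index. -/
def Stacked (κ : ℝ) (x : Fin n → ℂ) : Prop :=
  ∀ a b, a < b → ((x b - x a) * (1 - κ * Complex.I)).re = 0 ∧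
    0 < ((x b - x a) * (1 - κ * Complex.I)).im

/-- If the points a < b met at time s, then (1 - s)v + s w = 0 for their turned differences v, w in
`x` and `q`. Since w points straight up, v is vertical (unless s = 1) and then also points up, so
the sum cannot vanish. -/
theorem interp_injective {κ : ℝ} {x q : Fin n → ℂ} (hx : Unobstructed κ x) (hq : Stacked κ q)
    (s : I) : Function.Injective fun k => (1 - (s : ℝ) : ℂ) * x k + (s : ℝ) * q k := by
  have key : ∀ a b, a < b →
      (1 - (s : ℝ) : ℂ) * x a + (s : ℝ) * q a ≠ (1 - (s : ℝ) : ℂ) * x b + (s : ℝ) * q b := by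
    intro a b hab h
    have h0 : ((1 - s : ℝ) : ℂ) * ((x b - x a) * (1 - κ * Complex.I)) +
        (s : ℝ) * ((q b - q a) * (1 - κ * Complex.I)) = 0 := by
      push_cast
      linear_combination -(1 - κ * Complex.I) * h
    have hX := hx a b hab
    obtain ⟨hQ1, hQ2⟩ := hq a b hab
    generalize (x b - x a) * (1 - κ * Complex.I) = v at *
    generalize (q b - q a) * (1 - κ * Complex.I) = w at *
    have hre := congrArg Complex.re h0
    have him := congrArg Complex.im h0
    rw [Complex.add_re, Complex.re_ofReal_mul, Complex.re_ofReal_mul, hQ1, Complex.zero_re] at hre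
    rw [Complex.add_im, Complex.im_ofReal_mul, Complex.im_ofReal_mul, Complex.zero_im] at him
    have s0 := s.2.1
    have s1 := s.2.2
    rcases s1.lt_or_eq with hs | hs
    · have hv : v.re = 0 := by
        have : (1 - (s : ℝ)) * v.re = 0 := by linarith
        exact (mul_eq_zero.1 this).resolve_left (by linarith)
      have hv' := hX.resolve_left (not_not.2 hv)
      have := mul_pos (sub_pos.2 hs) hv'
      have := mul_nonneg s0 hQ2.le
      linarith
    · rw [hs] at him
      linarith
  intro a b h
  rcases lt_trichotomy a b with hab | hab | hab
  · exact absurd h (key a b hab)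
  · exact hab
  · exact absurd h.symm (key b a hab)

/-- The point at time `s` of the straight motion from `x` to `q`. -/
def interpConf (hU : Convex ℝ U) {κ : ℝ} (x q : OConf U n) (hx : Unobstructed κ x.1)
    (hq : Stacked κ q.1) (s : I) : OConf U n :=
  ⟨fun k => (1 - (s : ℝ) : ℂ) * x.1 k + (s : ℝ) * q.1 k, interp_injective hx hq s, fun k => by
    have := hU (x.2.2 k) (q.2.2 k) (sub_nonneg.2 s.2.2) s.2.1 (by ring)
    simpa using this⟩

/-- The straight motion from `x` to `q`. -/
def straightPath (hU : Convex ℝ U) {κ : ℝ} (x q : OConf U n) (hx : Unobstructed κ x.1)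
    (hq : Stacked κ q.1) {y : UConf U n} (hy : x.forget = y) : Path y q.forget where
  toFun s := (interpConf hU x q hx hq s).forget
  continuous_toFun := by
    refine OConf.continuous_forget.comp (Continuous.subtype_mk (continuous_pi fun k => ?_) _)
    fun_prop
  source' := by
    rw [← hy]
    congr 1
    apply Subtype.ext
    funext k
    simp [interpConf]
  target' := by
    congr 1
    apply Subtype.ext
    funext k
    simp [interpConf]

/-- An unobstructed motion is determined up to homotopy by its ends. -/
theorem mk_trans_straightPath (hU : Convex ℝ U) {κ : ℝ} (q : OConf U n) (hq : Stacked κ q.1)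
    {α : I → OConf U n} (hα : Continuous α) (hg : ∀ t, Unobstructed κ (α t).1) {x y : UConf U n}
    (p : Path x y) (hp : ∀ t, p t = (α t).forget) (h0 : (α 0).forget = x)
    (h1 : (α 1).forget = y) :
    (Path.Homotopic.Quotient.mk p).trans
        (Path.Homotopic.Quotient.mk (straightPath hU (α 1) q (hg 1) hq h1)) =
      Path.Homotopic.Quotient.mk (straightPath hU (α 0) q (hg 0) hq h0) := by
  have hα' : ∀ k, Continuous fun t => (α t).1 k := fun k =>
    (continuous_apply k).comp (continuous_subtype_val.comp hα)
  -- The square is (t, s) ↦ the point at time s of the straight motion from `α t`; its side s = 1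
  -- stays at `q`.
  refine mk_trans_eq_of_square ⟨fun ts => (interpConf hU (α ts.1) q (hg ts.1) hq ts.2).forget, ?_⟩
    _ _ _ (fun t => ?_) (fun s => rfl) (fun s => rfl) (fun t => ?_)
  · refine OConf.continuous_forget.comp (Continuous.subtype_mk (continuous_pi fun k => ?_) _)
    have := (hα' k).comp (continuous_fst (X := I) (Y := I))
    simp only [Function.comp_def] at this
    fun_prop
  · rw [hp]
    change _ = (interpConf hU (α t) q (hg t) hq 0).forget
    congr 1
    apply Subtype.ext
    funext k
    simp [interpConf]
  · change (interpConf hU (α t) q (hg t) hq 1).forget = _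
    congr 1
    apply Subtype.ext
    funext k
    simp [interpConf]

/-- Turning a vector of positive real part counterclockwise along an ellipse, it does not come to
point straight down. -/
theorem turn_unobstructed {v e : ℂ} (hv : 0 < v.re) (he : 0 ≤ e.im) (he0 : e ≠ 0) :
    (e * v).re ≠ 0 ∨ 0 < (e * v).im := by
  rw [or_iff_not_imp_left, not_not, Complex.mul_re, Complex.mul_im]
  intro h
  have hn : 0 < e.re * e.re + e.im * e.im := by
    rw [← Complex.normSq_apply]
    exact Complex.normSq_pos.2 he0
  -- This is the real part of v|e|² = ē(ev) when ev is purely imaginary.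
  have h1 : e.im * (e.re * v.im + e.im * v.re) = v.re * (e.re * e.re + e.im * e.im) := by
    linear_combination -e.re * h
  have h2 : 0 < e.im * (e.re * v.im + e.im * v.re) := by
    rw [h1]
    exact mul_pos hv hn
  exact (pos_iff_pos_of_mul_pos h2).1 (he.lt_of_ne fun h0 => by simp [← h0] at h2)

end Straight

/-! ### Thickness of half-twists -/

section Thickness

variable {U : Set ℂ} {n : ℕ}

theorem twistNhd_mono (a b : ℂ) {ε ε' : ℝ} (h' : 0 < ε') (h : ε' ≤ ε) :
    twistNhd a b ε' ⊆ twistNhd a b ε := by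
  rintro _ ⟨w, hw, rfl⟩
  have hε : 0 < ε := h'.trans_le h
  refine ⟨⟨w.re, ε' / ε * w.im⟩, ?_, ?_⟩
  · rw [mem_closedBall_zero_iff, ← sq_le_one_iff₀ (norm_nonneg _), Complex.sq_norm,
      Complex.normSq_apply] at hw ⊢
    have hr : ε' / ε ≤ 1 := (div_le_one hε).2 h
    have hr0 : 0 ≤ ε' / ε := (div_pos h' hε).le
    have h2 : (ε' / ε) * (ε' / ε) ≤ 1 := mul_le_one₀ hr hr0 hr
    have := mul_le_mul_of_nonneg_right h2 (mul_self_nonneg w.im)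
    dsimp only
    linarith
  · have : ε * (ε' / ε * w.im) = ε' * w.im := by field_simp
    simp only [this]

theorem OConf.Admissible.mono {p : OConf U n} {i j : Fin n} {ε ε' : ℝ} (hp : p.Admissible i j ε)
    (h' : 0 < ε') (h : ε' ≤ ε) : p.Admissible i j ε' :=
  ⟨h', (twistNhd_mono _ _ h' h).trans hp.2⟩

theorem continuous_ellipseArc : Continuous fun q : ℝ × ℝ => ellipseArc q.1 q.2 := by
  have : (fun q : ℝ × ℝ => ellipseArc q.1 q.2) = fun q : ℝ × ℝ =>
      ((Real.cos (Real.pi * q.2) : ℝ) : ℂ) + ((q.1 * Real.sin (Real.pi * q.2) : ℝ) : ℂ) *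
        Complex.I := by
    funext t
    exact Complex.mk_eq_add_mul_I _ _
  rw [this]
  fun_prop

theorem continuous_twistMotion (p : Fin n → ℂ) (i j k : Fin n) :
    Continuous fun q : ℝ × ℝ => twistMotion p i j q.1 q.2 k := by
  have := continuous_ellipseArc
  unfold twistMotion
  split_ifs <;> fun_prop

theorem twistMotion_zero (p : Fin n → ℂ) (i j : Fin n) (ε : ℝ) :
    twistMotion p i j ε 0 = p := by
  funext k
  have e : ellipseArc ε 0 = 1 := by apply Complex.ext <;> simp [ellipseArc]
  simp only [twistMotion, e]
  split_ifs with a b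
  · rw [a]; ring
  · rw [b]; ring
  · rfl

theorem twistMotion_one (p : Fin n → ℂ) (i j : Fin n) (ε : ℝ) :
    twistMotion p i j ε 1 = p ∘ Equiv.swap i j := by
  funext k
  have e : ellipseArc ε 1 = -1 := by apply Complex.ext <;> simp [ellipseArc]
  simp only [twistMotion, e, Function.comp]
  split_ifs with a b
  · rw [a, Equiv.swap_apply_left]; ring
  · rw [b, Equiv.swap_apply_right]; ring
  · rw [Equiv.swap_apply_of_ne_of_ne a b]

/-- The class of the half-twist does not depend on the thickness of the neighbourhood. -/
theorem halfTwistLoop_homotopic (p : OConf U n) {i j : Fin n} (hij : i ≠ j) {ε ε' : ℝ}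
    (h : p.Admissible i j ε) (hε : ε' ≤ ε) (h' : p.Admissible i j ε') :
    (halfTwistLoop p hij h).Homotopic (halfTwistLoop p hij h') := by
  -- The homotopy interpolates linearly between the thicknesses; all intermediate values are
  -- positive and at most `ε`, hence admissible.
  have hadm : ∀ s : I, p.Admissible i j ((1 - (s : ℝ)) * ε + s * ε') := fun s => by
    have s0 := s.2.1
    have s1 := s.2.2
    refine h.mono ?_ ?_
    · have := mul_le_mul_of_nonneg_left hε (sub_nonneg.2 s1)
      have := h'.1
      linarith
    · have := mul_le_mul_of_nonneg_left hε s0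
      linarith
  refine ⟨⟨⟨⟨fun st => OConf.forget ⟨_, twistMotion_conf p hij (hadm st.1) st.2⟩, ?_⟩, ?_, ?_⟩, ?_⟩⟩
  · refine OConf.continuous_forget.comp (Continuous.subtype_mk (continuous_pi fun k => ?_) _)
    exact (continuous_twistMotion p.1 i j k).comp (f := fun st : I × I =>
      ((1 - (st.1 : ℝ)) * ε + st.1 * ε', (st.2 : ℝ))) (by fun_prop)
  · intro t
    simp [halfTwistLoop]
  · intro t
    simp [halfTwistLoop]
  · intro s t ht
    apply Subtype.ext
    rcases ht with rfl | ht
    · change Set.range (twistMotion p.1 i j _ ((0 : I) : ℝ)) =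
        Set.range (twistMotion p.1 i j _ ((0 : I) : ℝ))
      rw [Set.Icc.coe_zero, twistMotion_zero, twistMotion_zero]
    · obtain rfl : t = 1 := ht
      change Set.range (twistMotion p.1 i j _ ((1 : I) : ℝ)) =
        Set.range (twistMotion p.1 i j _ ((1 : I) : ℝ))
      rw [Set.Icc.coe_one, twistMotion_one, twistMotion_one]

end Thickness

/-! ### Half-twists of neighbouring points are unobstructed -/

section Turn

variable {U : Set ℂ} {n : ℕ}

/-- In the coordinates turned by `1 - κ I`, the points are numbered from left to right. -/
def LeftToRight (κ : ℝ) (p : Fin n → ℂ) : Prop :=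
  ∀ a b, a < b → 0 < ((p b - p a) * (1 - κ * Complex.I)).re

/-- The points exchanged by a half-twist hardly leave the strip between their initial positions. -/
theorem twistMotion_re (p : Fin n → ℂ) {i j : Fin n} {ε : ℝ} (hε : 0 < ε) (w : ℂ)
    (hw : 0 ≤ ((p j - p i) * w).re) (t : ℝ) {m : Fin n} (hm : m = i ∨ m = j) :
    (p i * w).re - ε * |((p j - p i) * w).im| ≤ (twistMotion p i j ε t m * w).re ∧
    (twistMotion p i j ε t m * w).re ≤ (p j * w).re + ε * |((p j - p i) * w).im| := by
  have e1 : ((p i + p j) / 2 * w).re = ((p i * w).re + (p j * w).re) / 2 := by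
    rw [show (p i + p j) / 2 * w = (2⁻¹ : ℝ) * (p i * w + p j * w) by push_cast; ring,
      Complex.re_ofReal_mul, Complex.add_re]
    ring
  have e2 : ((p j - p i) / 2 * ellipseArc ε t * w).re =
      (((p j - p i) * w).re * Real.cos (Real.pi * t) -
        ((p j - p i) * w).im * (ε * Real.sin (Real.pi * t))) / 2 := by
    rw [show (p j - p i) / 2 * ellipseArc ε t * w =
      (2⁻¹ : ℝ) * ((p j - p i) * w * ellipseArc ε t) by push_cast; ring,
      Complex.re_ofReal_mul, Complex.mul_re]
    simp only [ellipseArc]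
    ring
  have e3 : ((p j - p i) * w).re = (p j * w).re - (p i * w).re := by rw [sub_mul, Complex.sub_re]
  -- The cosine term moves within the strip; only the sine term can leave it, by at most a multiple
  -- of `ε`.
  have b1 : |((p j - p i) * w).re * Real.cos (Real.pi * t)| ≤ ((p j - p i) * w).re := by
    rw [abs_mul, abs_of_nonneg hw]
    exact mul_le_of_le_one_right hw (Real.abs_cos_le_one _)
  have b2 : |((p j - p i) * w).im * (ε * Real.sin (Real.pi * t))| ≤
      ε * |((p j - p i) * w).im| := by
    rw [abs_mul, abs_mul, abs_of_pos hε, mul_comm]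
    refine mul_le_mul_of_nonneg_right ?_ (abs_nonneg _)
    exact mul_le_of_le_one_right hε.le (Real.abs_sin_le_one _)
  have b3 : 0 ≤ ε * |((p j - p i) * w).im| := mul_nonneg hε.le (abs_nonneg _)
  obtain ⟨b11, b12⟩ := abs_le.1 b1
  obtain ⟨b21, b22⟩ := abs_le.1 b2
  rcases eq_or_ne m i with hmi | hmi
  · rw [twistMotion, if_pos hmi, sub_mul ((p i + p j) / 2), Complex.sub_re, e1, e2]
    constructor <;> linarith
  · have hmj := hm.resolve_left hmi
    rw [twistMotion, if_neg hmi, if_pos hmj, add_mul, Complex.add_re, e1, e2]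
    constructor <;> linarith

/-- A thin half-twist of two neighbouring points changes the order of these two only. -/
theorem twistMotion_lt {κ : ℝ} {p : Fin n → ℂ} (hp : LeftToRight κ p) {i j : Fin n}
    (hij : (j : ℕ) = i + 1) {ε : ℝ} (hε : 0 < ε)
    (hs : ∀ a b, a < b → ε * |((p j - p i) * (1 - κ * Complex.I)).im| <
      ((p b - p a) * (1 - κ * Complex.I)).re) (t : ℝ) {u v : Fin n} (huv : u < v)
    (hne : ¬(u = i ∧ v = j)) :
    0 < ((twistMotion p i j ε t v - twistMotion p i j ε t u) * (1 - κ * Complex.I)).re := by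
  have hlt : i < j := by rw [Fin.lt_def]; omega
  have hm := fun m => twistMotion_re p (m := m) hε _ (hp i j hlt).le t
  have hs' : ∀ a b, a < b → ε * |((p j - p i) * (1 - κ * Complex.I)).im| <
      (p b * (1 - κ * Complex.I)).re - (p a * (1 - κ * Complex.I)).re := fun a b hab => by
    rw [← Complex.sub_re, ← sub_mul]
    exact hs a b hab
  have hfix : ∀ k, k ≠ i → k ≠ j → twistMotion p i j ε t k = p k := fun k h1 h2 => by
    rw [twistMotion, if_neg h1, if_neg h2]
  rw [sub_mul, Complex.sub_re, sub_pos]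
  -- As `i` and `j` are consecutive, any other index lies on one side of both; its gap to the nearer
  -- of them exceeds the error allowed by `hs`.
  have key : ∀ {k : Fin n}, k ≠ i → k ≠ j → (k < i ∨ j < k) := fun {k} h1 h2 => by
    rw [Fin.lt_def, Fin.lt_def]
    have h1' : (k : ℕ) ≠ i := fun e => h1 (Fin.ext e)
    have h2' : (k : ℕ) ≠ j := fun e => h2 (Fin.ext e)
    omega
  by_cases hu : u = i ∨ u = j
  · have hv1 : v ≠ i := by
      rintro rfl
      rcases hu with rfl | rfl
      · exact lt_irrefl _ huv
      · exact lt_asymm hlt huv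
    have hv2 : v ≠ j := by
      rintro rfl
      rcases hu with rfl | rfl
      · exact hne ⟨rfl, rfl⟩
      · exact lt_irrefl _ huv
    have hjv : j < v := (key hv1 hv2).resolve_left fun h => by
      rcases hu with rfl | rfl
      · exact lt_asymm h huv
      · exact lt_asymm (h.trans hlt) huv
    rw [hfix v hv1 hv2]
    have := (hm u hu).2
    have := hs' j v hjv
    linarith
  · have hu1 : u ≠ i := fun h => hu (Or.inl h)
    have hu2 : u ≠ j := fun h => hu (Or.inr h)
    rw [hfix u hu1 hu2]
    by_cases hv : v = i ∨ v = j
    · have hui : u < i := (key hu1 hu2).resolve_right fun h => by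
        rcases hv with rfl | rfl
        · exact lt_asymm (h.trans huv) hlt
        · exact lt_asymm h huv
      have := (hm v hv).1
      have := hs' u i hui
      linarith
    · rw [hfix v (fun h => hv (Or.inl h)) (fun h => hv (Or.inr h))]
      have := hp u v huv
      rw [sub_mul, Complex.sub_re] at this
      linarith

/-- A thin half-twist of two neighbouring points which have not yet changed places is
unobstructed. -/
theorem twistMotion_unobstructed {κ : ℝ} {p : Fin n → ℂ} (hp : LeftToRight κ p) {i j : Fin n}
    (hij : (j : ℕ) = i + 1) {ε : ℝ} (hε : 0 < ε)
    (hs : ∀ a b, a < b → ε * |((p j - p i) * (1 - κ * Complex.I)).im| <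
      ((p b - p a) * (1 - κ * Complex.I)).re) (τ : Equiv.Perm (Fin n))
    (hτ : τ.symm i < τ.symm j) (t : I) :
    Unobstructed κ (twistMotion p i j ε t ∘ τ) := by
  intro a b hab
  have hlt : i < j := by rw [Fin.lt_def]; omega
  simp only [Function.comp]
  rcases lt_trichotomy (τ a) (τ b) with h | h | h
  · by_cases hne : τ a = i ∧ τ b = j
    · have e : (twistMotion p i j ε t (τ b) - twistMotion p i j ε t (τ a)) *
          (1 - κ * Complex.I) = ellipseArc ε t * ((p j - p i) * (1 - κ * Complex.I)) := by
        rw [hne.1, hne.2, twistMotion, twistMotion, if_neg hlt.ne', if_pos rfl, if_pos rfl]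
        ring
      rw [e]
      refine turn_unobstructed (hp i j hlt) ?_ (ellipseArc_ne_zero hε _)
      refine mul_nonneg hε.le (Real.sin_nonneg_of_nonneg_of_le_pi ?_ ?_)
      · exact mul_nonneg Real.pi_pos.le t.2.1
      · exact mul_le_of_le_one_right Real.pi_pos.le t.2.2
    · exact Or.inl (twistMotion_lt hp hij hε hs t h hne).ne'
  · exact absurd (τ.injective h) hab.ne
  -- By `hτ` the left one of the two exchanged points has the smaller number, so this pair is not
  -- the exchanged one and keeps its order.
  · have hne : ¬(τ b = i ∧ τ a = j) := by
      rintro ⟨rfl, rfl⟩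
      rw [Equiv.symm_apply_apply, Equiv.symm_apply_apply] at hτ
      exact lt_asymm hτ hab
    refine Or.inl (ne_of_lt ?_)
    have := twistMotion_lt hp hij hε hs t h hne
    rw [← neg_sub, neg_mul, Complex.neg_re]
    linarith

theorem LeftToRight.unobstructed_comp {κ : ℝ} {p : Fin n → ℂ} (hp : LeftToRight κ p)
    (τ : Equiv.Perm (Fin n)) : Unobstructed κ (p ∘ τ) := by
  intro a b hab
  simp only [Function.comp]
  rcases lt_trichotomy (τ a) (τ b) with h | h | h
  · exact Or.inl (hp _ _ h).ne'
  · exact absurd (τ.injective h) hab.ne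
  · refine Or.inl (ne_of_lt ?_)
    have := hp _ _ h
    rw [← neg_sub, neg_mul, Complex.neg_re]
    linarith

/-- Renumber the points of a configuration. -/
def OConf.permute (p : OConf U n) (τ : Equiv.Perm (Fin n)) : OConf U n :=
  ⟨p.1 ∘ τ, p.2.1.comp τ.injective, fun k => p.2.2 (τ k)⟩

theorem OConf.forget_permute (p : OConf U n) (τ : Equiv.Perm (Fin n)) :
    (p.permute τ).forget = p.forget :=
  Subtype.ext (τ.surjective.range_comp p.1)

/-- The class of the straight motion that takes the point number `τ k` of `s` to the `k`-th point
of `q`. -/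
def fanClass (hU : Convex ℝ U) {κ : ℝ} (s : UConf U n) (hs : LeftToRight κ s.sorted.1)
    (q : OConf U n) (hq : Stacked κ q.1) (τ : Equiv.Perm (Fin n)) :
    Path.Homotopic.Quotient s q.forget :=
  .mk (straightPath hU (s.sorted.permute τ) q (hs.unobstructed_comp τ) hq
    ((s.sorted.forget_permute τ).trans s.forget_sorted))

/-- The hypothesis `hτ` says that the left point of the pair has the smaller number. In the
counterclockwise exchange the larger number then passes above the smaller one, which is what keeps
the motion unobstructed. -/
theorem artinGen_trans_fanClass (hU : IsOpen U) (hUc : Convex ℝ U) {κ : ℝ} (s : UConf U n)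
    (hs : LeftToRight κ s.sorted.1) (q : OConf U n) (hq : Stacked κ q.1) (i : ℕ) (hi : i + 1 < n)
    (τ : Equiv.Perm (Fin n)) (hτ : τ.symm ⟨i, by omega⟩ < τ.symm ⟨i + 1, hi⟩) :
    (FundamentalGroup.toPath (artinGen hU hUc s i hi)).trans
        (fanClass hUc s hs q hq (Equiv.swap ⟨i, by omega⟩ ⟨i + 1, hi⟩ * τ)) =
      fanClass hUc s hs q hq τ := by
  set p := s.sorted with hp
  have hadm := (exists_admissible hU hUc s.sorted (s.sorted_segment i hi)).choose_spec
  set ε₀ := (exists_admissible hU hUc s.sorted (s.sorted_segment i hi)).choose with hε₀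
  have hne : (⟨i, by omega⟩ : Fin n) ≠ ⟨i + 1, hi⟩ := fun e => by simp at e
  -- The thickness chosen in `artinGen` need not be small compared with the horizontal gaps, so a
  -- thinner ellipse replaces it.
  obtain ⟨ε, ⟨hs1, hε1⟩, hε⟩ : ∃ ε : ℝ, ((∀ a b : Fin n, a < b →
      ε * |((p.1 ⟨i + 1, hi⟩ - p.1 ⟨i, by omega⟩) * (1 - κ * Complex.I)).im| <
      ((p.1 b - p.1 a) * (1 - κ * Complex.I)).re) ∧ ε < ε₀) ∧ 0 < ε := by
    have hlim : ∀ c d : ℝ, 0 < d → ∀ᶠ ε in nhdsWithin (0 : ℝ) (Set.Ioi 0), ε * c < d := by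
      intro c d hd
      have : ContinuousAt (fun ε : ℝ => ε * c) 0 := by fun_prop
      exact (this.eventually_lt_const (by simpa using hd)).filter_mono nhdsWithin_le_nhds
    have h1 : ∀ᶠ ε in nhdsWithin (0 : ℝ) (Set.Ioi 0), ∀ a b : Fin n, a < b →
        ε * |((p.1 ⟨i + 1, hi⟩ - p.1 ⟨i, by omega⟩) * (1 - κ * Complex.I)).im| <
        ((p.1 b - p.1 a) * (1 - κ * Complex.I)).re := by
      simp only [Filter.eventually_all]
      exact fun a b hab => hlim _ _ (hs a b hab)
    have h2 : ∀ᶠ ε in nhdsWithin (0 : ℝ) (Set.Ioi 0), ε < ε₀ := by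
      simpa using hlim 1 ε₀ hadm.1
    exact ((h1.and h2).and self_mem_nhdsWithin).exists
  have hadm' : p.Admissible ⟨i, by omega⟩ ⟨i + 1, hi⟩ ε := hadm.mono hε hε1.le
  have hcls : FundamentalGroup.toPath (artinGen hU hUc s i hi) =
      .mk ((halfTwistLoop p hne hadm').cast s.forget_sorted.symm s.forget_sorted.symm) := by
    refine Path.Homotopic.Quotient.eq.2 ?_
    exact (halfTwistLoop_homotopic p hne hadm hε1.le hadm').pathCast _ _
  rw [hcls]
  -- The half-twist with numbering `τ` carried along: the underlying sets are unchanged, and the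
  -- numbering ends as the swap times `τ`.
  let β : I → OConf U n := fun t => OConf.permute ⟨_, twistMotion_conf p hne hadm' t⟩ τ
  have hβ : Continuous β := by
    refine Continuous.subtype_mk (continuous_pi fun k => ?_) _
    exact (continuous_twistMotion p.1 _ _ (τ k)).comp (f := fun t : I => (ε, (t : ℝ)))
      (by fun_prop)
  have hβ0 : β 0 = p.permute τ := by
    apply Subtype.ext
    simp [β, OConf.permute, twistMotion_zero]
  have hβ1 : β 1 = p.permute (Equiv.swap ⟨i, by omega⟩ ⟨i + 1, hi⟩ * τ) := by
    apply Subtype.ext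
    simp [β, OConf.permute, twistMotion_one, Function.comp_assoc]
  have := mk_trans_straightPath hUc q hq hβ
    (fun t => twistMotion_unobstructed hs rfl hε hs1 τ hτ t)
    ((halfTwistLoop p hne hadm').cast s.forget_sorted.symm s.forget_sorted.symm)
    (fun t => (OConf.forget_permute _ τ).symm)
    (by rw [hβ0, p.forget_permute, s.forget_sorted])
    (by rw [hβ1, p.forget_permute, s.forget_sorted])
  simp only [hβ0, hβ1] at this
  exact this

end Turn

/-! ### Choice of the tilted direction -/

section Direction

variable {U : Set ℂ} {n : ℕ}

theorem lexPair_lt {z w : ℂ} :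
    lexPair z < lexPair w ↔ z.re < w.re ∨ z.re = w.re ∧ z.im < w.im :=
  Prod.Lex.toLex_lt_toLex

/-- After a small clockwise turn, the points of a configuration are numbered from left to right. -/
theorem UConf.exists_leftToRight (s : UConf U n) : ∃ κ : ℝ, LeftToRight κ s.sorted.1 := by
  have h : ∀ᶠ κ in nhdsWithin (0 : ℝ) (Set.Ioi 0), LeftToRight κ s.sorted.1 := by
    unfold LeftToRight
    simp only [Filter.eventually_all]
    intro a b hab
    have hlt : lexPair (s.sorted.1 a) < lexPair (s.sorted.1 b) := s.strand_lt.2 hab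
    have e : ∀ κ : ℝ, ((s.sorted.1 b - s.sorted.1 a) * (1 - κ * Complex.I)).re =
        ((s.sorted.1 b).re - (s.sorted.1 a).re) +
        κ * ((s.sorted.1 b).im - (s.sorted.1 a).im) :=
      fun κ => by simp [mul_comm]
    simp only [e]
    -- A strict inequality of real parts survives a small `κ`; for equal real parts the term with
    -- `κ` > 0 decides.
    rcases lexPair_lt.1 hlt with h | ⟨h, h'⟩
    · have : ContinuousAt (fun κ : ℝ => ((s.sorted.1 b).re - (s.sorted.1 a).re) +
          κ * ((s.sorted.1 b).im - (s.sorted.1 a).im)) 0 := by fun_prop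
      exact (this.eventually_const_lt (u := 0) (by simpa using h)).filter_mono nhdsWithin_le_nhds
    · filter_upwards [self_mem_nhdsWithin] with κ hκ
      rw [h, sub_self, zero_add]
      exact mul_pos hκ (sub_pos.2 h')
  exact h.exists

/-- The points ηk·i(1 + κi) become ηk(1 + κ²)i after multiplication by 1 - κi; a small η > 0 keeps
them near 0, hence in `U`. -/
theorem exists_stacked (hU : IsOpen U) (h0 : (0 : ℂ) ∈ U) (κ : ℝ) :
    ∃ q : OConf U n, Stacked κ q.1 := by
  have h : ∀ᶠ η : ℝ in nhdsWithin (0 : ℝ) (Set.Ioi 0), ∀ k : Fin n,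
      (η : ℂ) * k * (Complex.I * (1 + κ * Complex.I)) ∈ U := by
    rw [Filter.eventually_all]
    intro k
    have : ContinuousAt (fun η : ℝ => (η : ℂ) * k * (Complex.I * (1 + κ * Complex.I))) 0 := by
      fun_prop
    exact (this.eventually_mem (hU.mem_nhds (by simpa using h0))).filter_mono nhdsWithin_le_nhds
  obtain ⟨η, hη, hη0⟩ := (h.and self_mem_nhdsWithin).exists
  have hst : Stacked κ fun k : Fin n => (η : ℂ) * k * (Complex.I * (1 + κ * Complex.I)) := by
    intro a b hab
    have e : ((η : ℂ) * b * (Complex.I * (1 + κ * Complex.I)) -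
        (η : ℂ) * a * (Complex.I * (1 + κ * Complex.I))) * (1 - κ * Complex.I) =
        ((η * ((b : ℝ) - a) * (1 + κ ^ 2) : ℝ) : ℂ) * Complex.I := by
      push_cast
      linear_combination (-(η : ℂ) * (b - a) * κ ^ 2 * Complex.I) * Complex.I_sq
    rw [e, Complex.re_ofReal_mul, Complex.im_ofReal_mul]
    refine ⟨by simp, ?_⟩
    have : (a : ℝ) < b := by exact_mod_cast hab
    rw [Complex.I_im, mul_one]
    exact mul_pos (mul_pos hη0 (sub_pos.2 this)) (by positivity)
  refine ⟨⟨_, fun a b h => ?_, hη⟩, hst⟩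
  by_contra hne
  rcases lt_or_gt_of_ne hne with hab | hab
  · have := (hst a b hab).2
    simp [h] at this
  · have := (hst b a hab).2
    simp [h] at this

end Direction

/-! ### Rotations of a centrally symmetric configuration -/

section Rotation

variable {U : Set ℂ} {n : ℕ}

theorem UConf.exists_strand_eq (s : UConf U n) {z : ℂ} (hz : z ∈ s.1) : ∃ k, s.strand k = z := by
  rw [← s.forget_sorted] at hz
  exact hz

/-- Negation reverses the lexicographic order, so negation followed by reversal of indices is a
strictly increasing self-map of `Fin n`, that is, the identity. -/
theorem UConf.strand_rev (s : UConf U n) (hs : ∀ z ∈ s.1, -z ∈ s.1) (k : Fin n) :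
    s.strand k.rev = -s.strand k := by
  choose g hg using fun k => s.exists_strand_eq (hs _ (s.strand_mem k))
  have hmono : StrictMono fun k => (g k).rev := by
    intro k l hkl
    rw [Fin.rev_lt_rev, ← s.strand_lt, hg, hg]
    rw [← s.strand_lt] at hkl
    simp only [lexPair_lt, Complex.neg_re, Complex.neg_im] at hkl ⊢
    rcases hkl with h | ⟨h, h'⟩
    · exact Or.inl (by linarith)
    · exact Or.inr ⟨by linarith, by linarith⟩
  have hid : (fun k => (g k).rev) = id := hmono.eq_id
  have : k.rev = g k := by
    rw [← Fin.rev_rev (g k)]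
    exact congrArg Fin.rev (congrFun hid k).symm
  rw [this, hg]

/-- The configuration turned by the angle `θ`. -/
def rotConf (p : OConf U n) (hp : ∀ (θ : ℝ) k, Complex.exp (θ * Complex.I) * p.1 k ∈ U) (θ : ℝ) :
    OConf U n :=
  ⟨fun k => Complex.exp (θ * Complex.I) * p.1 k,
    fun _ _ h => p.2.1 (mul_left_cancel₀ (Complex.exp_ne_zero _) h), hp θ⟩

theorem continuous_rotConf (p : OConf U n)
    (hp : ∀ (θ : ℝ) k, Complex.exp (θ * Complex.I) * p.1 k ∈ U) : Continuous (rotConf p hp) := by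
  refine Continuous.subtype_mk (continuous_pi fun k => ?_) _
  fun_prop

/-- Each difference of a later and an earlier point starts in the open right half-plane and turns by
an angle in [0, π], so it never points straight down. -/
theorem rotConf_unobstructed {κ : ℝ} (p : OConf U n)
    (hp : ∀ (θ : ℝ) k, Complex.exp (θ * Complex.I) * p.1 k ∈ U) (h : LeftToRight κ p.1) (t : I) :
    Unobstructed κ (rotConf p hp (Real.pi * t)).1 := by
  intro a b hab
  have e : ((rotConf p hp (Real.pi * t)).1 b - (rotConf p hp (Real.pi * t)).1 a) *
      (1 - κ * Complex.I) = Complex.exp ((Real.pi * t : ℝ) * Complex.I) *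
        ((p.1 b - p.1 a) * (1 - κ * Complex.I)) := by
    simp only [rotConf]
    ring
  rw [e]
  refine turn_unobstructed (h a b hab) ?_ (Complex.exp_ne_zero _)
  rw [Complex.exp_ofReal_mul_I_im]
  refine Real.sin_nonneg_of_nonneg_of_le_pi ?_ ?_
  · exact mul_nonneg Real.pi_pos.le t.2.1
  · exact mul_le_of_le_one_right Real.pi_pos.le t.2.2

theorem rotConf_zero (p : OConf U n)
    (hp : ∀ (θ : ℝ) k, Complex.exp (θ * Complex.I) * p.1 k ∈ U) : rotConf p hp 0 = p := by
  apply Subtype.ext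
  simp [rotConf]

variable (s : UConf U n)
  (hp : ∀ (θ : ℝ) k, Complex.exp (θ * Complex.I) * s.sorted.1 k ∈ U)

theorem rotConf_pi (hs : ∀ z ∈ s.1, -z ∈ s.1) : rotConf s.sorted hp Real.pi = s.sorted.permute Fin.revPerm := by
  apply Subtype.ext
  funext k
  change Complex.exp (Real.pi * Complex.I) * s.strand k = s.strand k.rev
  rw [Complex.exp_pi_mul_I, s.strand_rev hs]
  ring

theorem forget_rotConf_add_pi (hs : ∀ z ∈ s.1, -z ∈ s.1) (θ : ℝ) :
    (rotConf s.sorted hp (θ + Real.pi)).forget = (rotConf s.sorted hp θ).forget := by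
  rw [← OConf.forget_permute (rotConf s.sorted hp θ) Fin.revPerm]
  congr 1
  apply Subtype.ext
  funext k
  change Complex.exp ((θ + Real.pi : ℝ) * Complex.I) * s.strand k =
    Complex.exp (θ * Complex.I) * s.strand k.rev
  rw [s.strand_rev hs, Complex.ofReal_add, add_mul, Complex.exp_add, Complex.exp_pi_mul_I]
  ring

/-- The loop of a centrally symmetric configuration turned by `m` half-turns. -/
def rotLoop (hs : ∀ z ∈ s.1, -z ∈ s.1) (m : ℕ) : Path s s where
  toFun t := (rotConf s.sorted hp (m * Real.pi * t)).forget
  continuous_toFun :=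
    OConf.continuous_forget.comp ((continuous_rotConf s.sorted hp).comp (by fun_prop))
  source' := by
    rw [Set.Icc.coe_zero, mul_zero, rotConf_zero, s.forget_sorted]
  target' := by
    rw [Set.Icc.coe_one, mul_one]
    induction m with
    | zero => rw [Nat.cast_zero, zero_mul, rotConf_zero, s.forget_sorted]
    | succ m ih => rw [Nat.cast_succ, add_mul, one_mul, forget_rotConf_add_pi s hp hs, ih]

/-- The straight path between two real numbers. -/
def realPath (a b : ℝ) : Path a b where
  toFun t := a + (b - a) * t
  source' := by simp
  target' := by simp

theorem rotLoop_succ (hs : ∀ z ∈ s.1, -z ∈ s.1) (m : ℕ) :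
    (Path.Homotopic.Quotient.mk (rotLoop s hp hs 1)).trans (.mk (rotLoop s hp hs m)) =
      .mk (rotLoop s hp hs (m + 1)) := by
  refine trans_eq_of_lift
    ⟨fun θ => (rotConf s.sorted hp θ).forget,
      OConf.continuous_forget.comp (continuous_rotConf s.sorted hp)⟩
    (realPath 0 Real.pi) (realPath Real.pi ((m + 1) * Real.pi)) (realPath 0 ((m + 1) * Real.pi))
    _ _ _ (fun t => ?_) (fun t => ?_) (fun t => ?_)
  · simp [rotLoop, realPath]
  -- The second loop is lifted to angles starting at π instead of 0, which leaves the unordered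
  -- configurations unchanged.
  · change (rotConf s.sorted hp (m * Real.pi * t)).forget =
      (rotConf s.sorted hp (Real.pi + ((m + 1) * Real.pi - Real.pi) * t)).forget
    rw [← forget_rotConf_add_pi s hp hs]
    congr 2
    ring
  · simp [rotLoop, realPath]

theorem rotLoop_trans_fanClass (hs : ∀ z ∈ s.1, -z ∈ s.1)
    (hU : Convex ℝ U) {κ : ℝ} (h : LeftToRight κ s.sorted.1)
    (q : OConf U n) (hq : Stacked κ q.1) :
    (Path.Homotopic.Quotient.mk (rotLoop s hp hs 1)).trans
      (fanClass hU s h q hq Fin.revPerm) = fanClass hU s h q hq 1 := by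
  let β : I → OConf U n := fun t => rotConf s.sorted hp (Real.pi * t)
  have hβ : Continuous β := (continuous_rotConf s.sorted hp).comp (by fun_prop)
  have hβ0 : β 0 = s.sorted.permute 1 := by
    simp only [β, Set.Icc.coe_zero, mul_zero, rotConf_zero]
    rfl
  have hβ1 : β 1 = s.sorted.permute Fin.revPerm := by
    simp only [β, Set.Icc.coe_one, mul_one]
    exact rotConf_pi s hp hs
  have := mk_trans_straightPath hU q hq hβ (fun t => rotConf_unobstructed s.sorted hp h t)
    (rotLoop s hp hs 1) (fun t => by simp [rotLoop, β])
    (by rw [hβ0, OConf.forget_permute, s.forget_sorted])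
    (by rw [hβ1, OConf.forget_permute, s.forget_sorted])
  simp only [hβ0, hβ1] at this
  exact this

end Rotation

/-! ### Half-turns as words in the Artin generators -/

/-- The half-turn of a centrally symmetric configuration of four points. -/
theorem rotLoop_one_eq {U : Set ℂ} (hU : IsOpen U) (hUc : Convex ℝ U) (h0 : (0 : ℂ) ∈ U)
    (s : UConf U 4) (hp : ∀ (θ : ℝ) k, Complex.exp (θ * Complex.I) * s.sorted.1 k ∈ U)
    (hs : ∀ z ∈ s.1, -z ∈ s.1) :
    FundamentalGroup.fromPath (.mk (rotLoop s hp hs 1)) =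
      (artinGen hU hUc s 1 (by norm_num) * artinGen hU hUc s 0 (by norm_num) *
        artinGen hU hUc s 2 (by norm_num)) ^ 2 := by
  obtain ⟨κ, hκ⟩ := s.exists_leftToRight
  obtain ⟨q, hq⟩ := exists_stacked (n := 4) hU h0 κ
  have hR := rotLoop_trans_fanClass s hp hs hUc hκ q hq
  have step := artinGen_trans_fanClass hU hUc s hκ q hq
  -- Indices start from 0, so 2, 0, 1 stand for σ₃, σ₁, σ₂. The six swaps form a reduced word of the
  -- reversal; each `decide` on an inequality checks that the pair has not yet been exchanged.
  have e1 := step 2 (by norm_num) 1 (by decide)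
  have e2 := step 0 (by norm_num) _ (by decide : (Equiv.swap (2 : Fin 4) 3 * 1).symm 0 <
    (Equiv.swap (2 : Fin 4) 3 * 1).symm 1)
  have e3 := step 1 (by norm_num) _ (by decide :
    (Equiv.swap 0 1 * (Equiv.swap (2 : Fin 4) 3 * 1)).symm 1 <
    (Equiv.swap 0 1 * (Equiv.swap (2 : Fin 4) 3 * 1)).symm 2)
  have e4 := step 2 (by norm_num) _ (by decide :
    (Equiv.swap 1 2 * (Equiv.swap 0 1 * (Equiv.swap (2 : Fin 4) 3 * 1))).symm 2 <
    (Equiv.swap 1 2 * (Equiv.swap 0 1 * (Equiv.swap (2 : Fin 4) 3 * 1))).symm 3)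
  have e5 := step 0 (by norm_num) _ (by decide :
    (Equiv.swap 2 3 * (Equiv.swap 1 2 * (Equiv.swap 0 1 * (Equiv.swap (2 : Fin 4) 3 * 1)))).symm 0 <
    (Equiv.swap 2 3 * (Equiv.swap 1 2 * (Equiv.swap 0 1 * (Equiv.swap (2 : Fin 4) 3 * 1)))).symm 1)
  have e6 := step 1 (by norm_num) _ (by decide :
    (Equiv.swap 0 1 * (Equiv.swap 2 3 * (Equiv.swap 1 2 * (Equiv.swap 0 1 *
      (Equiv.swap (2 : Fin 4) 3 * 1))))).symm 1 <
    (Equiv.swap 0 1 * (Equiv.swap 2 3 * (Equiv.swap 1 2 * (Equiv.swap 0 1 *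
      (Equiv.swap (2 : Fin 4) 3 * 1))))).symm 2)
  have hrev : Equiv.swap 1 2 * (Equiv.swap 0 1 * (Equiv.swap 2 3 * (Equiv.swap 1 2 *
      (Equiv.swap 0 1 * (Equiv.swap (2 : Fin 4) 3 * 1))))) = Fin.revPerm := by decide
  have e6' : (FundamentalGroup.toPath (artinGen hU hUc s 1 (by norm_num))).trans
      (fanClass hUc s hκ q hq Fin.revPerm) = _ := hrev ▸ e6
  have key := hR.trans (e1.symm.trans (congrArg _ (e2.symm.trans (congrArg _ (e3.symm.trans
    (congrArg _ (e4.symm.trans (congrArg _ (e5.symm.trans (congrArg _ e6'.symm))))))))))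
  -- Both sides end with the fan of the reversal, which is cancelled.
  have := congrArg (fun c => c.trans (fanClass hUc s hκ q hq Fin.revPerm).symm) key
  simp only [Path.Homotopic.Quotient.trans_assoc, Path.Homotopic.Quotient.trans_symm,
    Path.Homotopic.Quotient.trans_refl] at this
  -- A product in `FundamentalGroup` traverses its right factor first, so the path beginning with σ₃
  -- is the word ending in σ₃.
  rw [pow_two, FundamentalGroup.mul_def, FundamentalGroup.mul_def, FundamentalGroup.mul_def,
    Path.Homotopic.Quotient.trans_assoc, Path.Homotopic.Quotient.trans_assoc]
  exact this

/-- The loop of three half-turns of a centrally symmetric configuration of four points. -/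
theorem mk_eq_pow_six {U : Set ℂ} (hU : IsOpen U) (hUc : Convex ℝ U) (h0 : (0 : ℂ) ∈ U) {n : ℕ}
    (hn : n = 4) (s : UConf U n) (hp : ∀ (θ : ℝ), ∀ z ∈ s.1, Complex.exp (θ * Complex.I) * z ∈ U)
    (hs : ∀ z ∈ s.1, -z ∈ s.1) (γ : Path s s)
    (hγ : ∀ t : I, ∀ z ∈ s.1, Complex.exp ((3 * Real.pi * t : ℝ) * Complex.I) * z ∈ (γ t).1) :
    FundamentalGroup.fromPath (.mk γ) =
      (artinGen hU hUc s 1 (by omega) * artinGen hU hUc s 0 (by omega) *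
        artinGen hU hUc s 2 (by omega)) ^ 6 := by
  subst hn
  have hp' : ∀ (θ : ℝ) k, Complex.exp (θ * Complex.I) * s.sorted.1 k ∈ U :=
    fun θ k => hp θ _ (s.strand_mem k)
  -- At each time the rotated points lie in the set `γ t`, which has equally many elements.
  have hγ' : γ = rotLoop s hp' hs 3 := by
    refine Path.ext (funext fun t => Subtype.ext ?_)
    refine ((γ t).finite.eq_of_subset_of_encard_le' ?_ ?_).symm
    · rintro _ ⟨k, rfl⟩
      exact hγ t _ (s.strand_mem k)
    · rw [(γ t).2.2, (rotLoop s hp' hs 3 t).2.2]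
  have h3 : FundamentalGroup.fromPath (.mk (rotLoop s hp' hs 3)) =
      FundamentalGroup.fromPath (.mk (rotLoop s hp' hs 1)) ^ 3 := by
    rw [pow_succ, pow_two, FundamentalGroup.mul_def, FundamentalGroup.mul_def]
    exact ((congrArg _ (rotLoop_succ s hp' hs 1)).trans (rotLoop_succ s hp' hs 2)).symm
  rw [hγ', h3, rotLoop_one_eq hU hUc h0, ← pow_mul]

/-! ### The fundamental group of the punctured closed disc -/

section PuncturedDisc

/-- The closed left half-plane. -/
def leftHalf : Set ℂ := {z | z.re ≤ 0}

theorem convex_leftHalf : Convex ℝ leftHalf := convex_halfSpace_re_le 0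

instance : ContractibleSpace leftHalf := convex_leftHalf.contractibleSpace ⟨0, by simp [leftHalf]⟩

/-- The straight path in the left half-plane. -/
def leftHalfPath (a b : leftHalf) : Path a b where
  toFun t := ⟨(1 - (t : ℝ) : ℂ) * a + (t : ℝ) * b, by
    have := convex_leftHalf a.2 b.2 (sub_nonneg.2 t.2.2) t.2.1 (by ring)
    simpa using this⟩
  continuous_toFun := by fun_prop
  source' := by simp
  target' := by simp

/-- The point `2πik` of the left half-plane. -/
def leftHalfPeriod (k : ℤ) : leftHalf := ⟨k * (2 * Real.pi * Complex.I), by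
  rw [leftHalf, Set.mem_ofPred_eq]
  simp⟩

variable {r : ℝ} {B : Set ℂ}

/-- The covering of the punctured closed disc by the left half-plane. -/
def expDisc (hB : ∀ x ∈ Metric.closedBall (0 : ℂ) r, x ∈ B → x = 0)
    (M : ↥(Metric.closedBall (0 : ℂ) r \ B)) (hM0 : (M : ℂ) ≠ 0) :
    C(leftHalf, ↥(Metric.closedBall (0 : ℂ) r \ B)) where
  toFun z := ⟨M * Complex.exp z, by
    have hmem : (M : ℂ) * Complex.exp z ∈ Metric.closedBall (0 : ℂ) r := by
      have h := M.2.1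
      rw [mem_closedBall_zero_iff] at h ⊢
      rw [norm_mul, Complex.norm_exp]
      exact (mul_le_of_le_one_right (norm_nonneg _) (Real.exp_le_one_iff.2 z.2)).trans h
    exact ⟨hmem, fun h => mul_ne_zero hM0 (Complex.exp_ne_zero _) (hB _ hmem h)⟩⟩
  continuous_toFun := by fun_prop

variable (hB : ∀ x ∈ Metric.closedBall (0 : ℂ) r, x ∈ B → x = 0)
  (M : ↥(Metric.closedBall (0 : ℂ) r \ B)) (hM0 : (M : ℂ) ≠ 0)

theorem expDisc_period (k : ℤ) : expDisc hB M hM0 (leftHalfPeriod k) = M := by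
  apply Subtype.ext
  change (M : ℂ) * Complex.exp (k * (2 * Real.pi * Complex.I)) = M
  rw [Complex.exp_int_mul_two_pi_mul_I, mul_one]

/-- The loop winding `k` times around the puncture. -/
def windLoop (k : ℤ) : Path M M :=
  ((leftHalfPath (leftHalfPeriod 0) (leftHalfPeriod k)).map (expDisc hB M hM0).continuous).cast
    (expDisc_period hB M hM0 0).symm (expDisc_period hB M hM0 k).symm

/-- The second loop is lifted to start at 2πik, where the lift of the first one ends. -/
theorem windLoop_add (k l : ℤ) :
    (Path.Homotopic.Quotient.mk (windLoop hB M hM0 k)).trans (.mk (windLoop hB M hM0 l)) =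
      .mk (windLoop hB M hM0 (k + l)) := by
  refine trans_eq_of_lift (expDisc hB M hM0) (leftHalfPath (leftHalfPeriod 0) (leftHalfPeriod k))
    (leftHalfPath (leftHalfPeriod k) (leftHalfPeriod (k + l)))
    (leftHalfPath (leftHalfPeriod 0) (leftHalfPeriod (k + l))) _ _ _ (fun t => rfl) (fun t => ?_)
    (fun t => rfl)
  apply Subtype.ext
  change (M : ℂ) * Complex.exp ((1 - (t : ℝ) : ℂ) * ((0 : ℤ) * (2 * Real.pi * Complex.I)) +
    (t : ℝ) * (l * (2 * Real.pi * Complex.I))) = M * Complex.exp ((1 - (t : ℝ) : ℂ) *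
    (k * (2 * Real.pi * Complex.I)) + (t : ℝ) * ((k + l : ℤ) * (2 * Real.pi * Complex.I)))
  have e : (1 - (t : ℝ) : ℂ) * (k * (2 * Real.pi * Complex.I)) +
      (t : ℝ) * ((k + l : ℤ) * (2 * Real.pi * Complex.I)) =
      (1 - (t : ℝ) : ℂ) * ((0 : ℤ) * (2 * Real.pi * Complex.I)) +
      (t : ℝ) * (l * (2 * Real.pi * Complex.I)) + k * (2 * Real.pi * Complex.I) := by
    push_cast
    ring
  rw [e, Complex.exp_add _ (k * (2 * Real.pi * Complex.I)), Complex.exp_int_mul_two_pi_mul_I,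
    mul_one]

/-- Winding numbers as a homomorphism to the fundamental group. -/
def windHom : Multiplicative ℤ →* FundamentalGroup ↥(Metric.closedBall (0 : ℂ) r \ B) M :=
  MonoidHom.mk' (fun k => FundamentalGroup.fromPath (.mk (windLoop hB M hM0 k.toAdd)))
    fun k l => by
      rw [FundamentalGroup.mul_def, mul_comm k l]
      exact (windLoop_add hB M hM0 _ _).symm

/-- Lift γ/M through exp, starting at 0. As M lies on the boundary circle, |γ/M| ≤ 1, so the lift
stays in the left half-plane; it ends at a logarithm 2πik of 1, and the half-plane is simply
connected. -/
theorem windHom_surjective (h0 : (0 : ℂ) ∈ B) (hM : ‖(M : ℂ)‖ = r) :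
    Function.Surjective (windHom hB M hM0) := by
  intro g
  obtain ⟨γ, rfl⟩ := Path.Homotopic.Quotient.mk_surjective (FundamentalGroup.toPath g)
  have hne : ∀ t, ((γ t : ℂ) / M) ≠ 0 := fun t h => by
    rcases div_eq_zero_iff.1 h with h | h
    · exact (γ t).2.2 (h.symm ▸ h0 : (γ t : ℂ) ∈ B)
    · exact hM0 h
  obtain ⟨f, hf, hf0⟩ := Complex.isCoveringMap_exp.exists_path_lifts
    ⟨fun t => (⟨(γ t : ℂ) / M, hne t⟩ : {z : ℂ // z ≠ 0}), by fun_prop⟩ 0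
    (Subtype.ext (by simp [div_self hM0]))
  have hexp : ∀ t, Complex.exp (f t) = γ t / M := fun t =>
    congrArg Subtype.val (congrFun hf t)
  have hre : ∀ t, f t ∈ leftHalf := fun t => by
    have h1 : ‖(γ t : ℂ)‖ ≤ ‖(M : ℂ)‖ := by
      rw [hM]
      exact mem_closedBall_zero_iff.1 (γ t).2.1
    have h2 : Real.exp (f t).re ≤ 1 := by
      rw [← Complex.norm_exp, hexp, norm_div]
      exact div_le_one_of_le₀ h1 (norm_nonneg _)
    exact Real.exp_le_one_iff.1 h2
  obtain ⟨k, hk⟩ : ∃ k : ℤ, f 1 = k * (2 * Real.pi * Complex.I) := by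
    rw [← Complex.exp_eq_one_iff, hexp, γ.target, div_self hM0]
  let p : Path (leftHalfPeriod 0) (leftHalfPeriod k) :=
    { toFun := fun t => ⟨f t, hre t⟩
      continuous_toFun := by fun_prop
      source' := Subtype.ext (by simp [hf0, leftHalfPeriod])
      target' := Subtype.ext hk }
  refine ⟨Multiplicative.ofAdd k, ?_⟩
  refine mk_eq_of_lift (expDisc hB M hM0) (leftHalfPath (leftHalfPeriod 0) (leftHalfPeriod k)) p
    _ _ (fun t => rfl) (fun t => Subtype.ext ?_)
  change (γ t : ℂ) = M * Complex.exp (f t)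
  rw [hexp, mul_div_cancel₀ _ hM0]

theorem zpowers_windLoop (h0 : (0 : ℂ) ∈ B) (hM : ‖(M : ℂ)‖ = r) :
    Subgroup.zpowers (FundamentalGroup.fromPath (.mk (windLoop hB M hM0 1))) = ⊤ := by
  rw [eq_top_iff]
  intro g _
  obtain ⟨k, rfl⟩ := windHom_surjective hB M hM0 h0 hM g
  refine ⟨k.toAdd, ?_⟩
  change windHom hB M hM0 (Multiplicative.ofAdd 1) ^ k.toAdd = _
  rw [← map_zpow]
  congr 1
  rw [← ofAdd_zsmul]
  simp

end PuncturedDisc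

/-! ### The circle and the symmetry of the two cusps -/

theorem circleLoop_eq_windLoop (F : ℂ[X][X]) {r : ℝ} (hr : 0 < r)
    (hN : ∀ x ∈ Metric.closedBall (0 : ℂ) r, x ∈ branchSet F → x = 0)
    (M : ↥(Metric.closedBall (0 : ℂ) r \ branchSet F)) (hM : (M : ℂ) ∈ Metric.sphere (0 : ℂ) r)
    (hM0 : (M : ℂ) ≠ 0) : circleLoop F hr hN M hM = windLoop hN M hM0 1 := by
  refine Path.ext (funext fun t => Subtype.ext ?_)
  change (M : ℂ) * Complex.exp (2 * Real.pi * t * Complex.I) =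
    M * Complex.exp ((1 - (t : ℝ) : ℂ) * ((0 : ℤ) * (2 * Real.pi * Complex.I)) +
      (t : ℝ) * ((1 : ℤ) * (2 * Real.pi * Complex.I)))
  congr 2
  push_cast
  ring

/-- With weights 2 for x and 3 for y the equation is homogeneous of degree 12. -/
theorem exp_mul_mem_fibre_twoCusps {x y : ℂ} (hy : y ∈ fibre twoCusps x) (θ : ℂ) :
    Complex.exp (3 * θ) * y ∈ fibre twoCusps (x * Complex.exp (2 * θ)) := by
  rw [mem_fibre_twoCusps] at hy ⊢
  have e3 : Complex.exp (3 * θ) = Complex.exp θ ^ 3 := by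
    rw [← Complex.exp_nat_mul]
    norm_num
  have e2 : Complex.exp (2 * θ) = Complex.exp θ ^ 2 := by
    rw [← Complex.exp_nat_mul]
    norm_num
  rw [e3, e2]
  linear_combination Complex.exp θ ^ 12 * hy

end BraidMonodromy

end

theorem mainTheorem7 (r : ℝ) (hr : 0 < r) (c : ℂ) (R : ℝ)
    (hD : ∀ x ∈ Metric.closedBall (0 : ℂ) r,
      BraidMonodromy.fibre BraidMonodromy.twoCusps x ⊆ Metric.ball c R)
    (M : ↥(Metric.closedBall (0 : ℂ) r \ BraidMonodromy.branchSet BraidMonodromy.twoCusps))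
    (hM : (M : ℂ) ∈ Metric.sphere (0 : ℂ) r) :
    let φ := BraidMonodromy.braidMonodromy BraidMonodromy.twoCusps hD M
    let Γ := FundamentalGroup.fromPath (Path.Homotopic.Quotient.mk
      (BraidMonodromy.circleLoop BraidMonodromy.twoCusps hr
        (BraidMonodromy.branchSet_twoCusps_disc r) M hM))
    let σ := BraidMonodromy.artinGen Metric.isOpen_ball (convex_ball c R)
      (BraidMonodromy.fibreConf BraidMonodromy.twoCusps hD M)
    let σ₁ := σ 0 (by rw [BraidMonodromy.natDegree_twoCusps]; norm_num)
    let σ₂ := σ 1 (by rw [BraidMonodromy.natDegree_twoCusps]; norm_num)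
    let σ₃ := σ 2 (by rw [BraidMonodromy.natDegree_twoCusps]; norm_num)
    φ Γ = (σ₂ * σ₁ * σ₃) ^ 6 ∧ φ.range = Subgroup.zpowers ((σ₂ * σ₁ * σ₃) ^ 6) := by
  intro φ Γ σ σ₁ σ₂ σ₃
  have hMr : ‖(M : ℂ)‖ = r := mem_sphere_zero_iff_norm.1 hM
  have hM0 : (M : ℂ) ≠ 0 := by
    rw [← norm_pos_iff, hMr]
    exact hr
  have hΓ : Subgroup.zpowers Γ = ⊤ := by
    have := BraidMonodromy.zpowers_windLoop (BraidMonodromy.branchSet_twoCusps_disc r) M hM0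
      (by rw [BraidMonodromy.branchSet_twoCusps]; rfl) hMr
    rwa [← BraidMonodromy.circleLoop_eq_windLoop BraidMonodromy.twoCusps hr _ M hM hM0] at this
  have hmain : φ Γ = (σ₂ * σ₁ * σ₃) ^ 6 := by
    refine BraidMonodromy.mk_eq_pow_six Metric.isOpen_ball (convex_ball c R) ?_
      BraidMonodromy.natDegree_twoCusps _ (fun θ z hz => ?_) (fun z hz => ?_)
      ((BraidMonodromy.circleLoop BraidMonodromy.twoCusps hr
        (BraidMonodromy.branchSet_twoCusps_disc r) M hM).map
        (BraidMonodromy.continuous_fibreConf BraidMonodromy.twoCusps hD)) (fun t z hz => ?_)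
    · refine hD 0 (by simpa using hr.le) ?_
      rw [BraidMonodromy.mem_fibre_twoCusps]
      simp
    -- The disc need not be centred at 0. But e^{iθ}z lies over M e^{2iθ/3}, which is still in E, so
    -- the disc contains it.
    · have h := BraidMonodromy.exp_mul_mem_fibre_twoCusps hz (θ / 3 * Complex.I)
      rw [show (3 : ℂ) * (θ / 3 * Complex.I) = θ * Complex.I by ring] at h
      refine hD _ ?_ h
      have e : (2 : ℂ) * (θ / 3 * Complex.I) = ((2 * (θ / 3) : ℝ) : ℂ) * Complex.I := by
        push_cast
        ring
      rw [mem_closedBall_zero_iff, norm_mul, e, Complex.norm_exp_ofReal_mul_I, mul_one, hMr]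
    · change z ∈ BraidMonodromy.fibre _ _ at hz
      change -z ∈ BraidMonodromy.fibre _ _
      rw [BraidMonodromy.mem_fibre_twoCusps] at hz ⊢
      rwa [neg_sq]
    -- While the base point turns by 2πt, the fibre turns by 3πt.
    · have h := BraidMonodromy.exp_mul_mem_fibre_twoCusps hz (Real.pi * t * Complex.I)
      change _ ∈ BraidMonodromy.fibre _ ((M : ℂ) * Complex.exp (2 * Real.pi * t * Complex.I))
      rw [show (2 : ℂ) * (Real.pi * t * Complex.I) = 2 * Real.pi * t * Complex.I by ring] at h
      rwa [show ((3 * Real.pi * t : ℝ) : ℂ) * Complex.I = 3 * (Real.pi * t * Complex.I) by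
        push_cast; ring]
  refine ⟨hmain, ?_⟩
  rw [← hmain, MonoidHom.range_eq_map, ← hΓ, MonoidHom.map_zpowers]
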